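/- Let $G$ be a locally compact topological group (for instance a compact Lie group), and let $H$, $K^-$, $K^+$ be closed subgroups of $G$ with $H\le K^-$ and $H\le K^+$. Let $\pi_{K^\pm}\colon G/H\to G/K^\pm$ be the projections, and let $X$ be the double mapping cylinder of $G/K^-\xleftarrow{\pi_{K^-}}G/H\xrightarrow{\pi_{K^+}}G/K^+$, i.e. the quotient of $G/K^-\sqcup G/K^+\sqcup (G/H\times[-1,1])$ by $(x,-1)\sim\pi_{K^-}(x)$ and $(x,1)\sim\pi_{K^+}(x)$, with its standard $G$-CW structure: $0$-cells $G/K^-\times D^0$ and $G/K^+\times D^0$ and a single $1$-cell $G/H\times D^1$. Let $F$ be a coefficient system for $G$: a contravariant functor to abelian groups from the category of orbits $G/\Gamma$ ($\Gamma\le G$ closed) and $G$-maps, such that $G$-homotopic maps induce the same homomorphism. For a $G$-CW complex $Z$ with skeleta $Z_n$ (and $Z_{-1}=\varnothing$), the Bredon cohomology $H^*_G(Z;F)$ is the cohomology of the cochain complex $$C^n_G(Z;F)=\mathrm{Nat}(\underline H_n,F),\qquad \underline H_n(G/\Gamma)=H_n\big(Z_n^\Gamma,Z_{n-1}^\Gamma;\mathbb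 Z\big),$$ of groups of natural transformations, where $H_n$ is relative singular homology and the coboundary is induced by the connecting homomorphisms of the triples $(Z_{n+1}^\Gamma,Z_n^\Gamma,Z_{n-1}^\Gamma)$. Then $H^n_G(X;F)=0$ for all $n\ge 2$, and there are group isomorphisms $$H^0_G(X;F)\;\cong\; F(G/K^-)\times_{F(G/H)}F(G/K^+)=\{(a,b): F(\pi_{K^-})(a)=F(\pi_{K^+})(b)\},$$ $$H^1_G(X;F)\;\cong\; F(G/H)\big/\big(\operatorname{im}F(\pi_{K^-})+\operatorname{im}F(\pi_{K^+})\big).$$ -/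

import Mathlib

open CategoryTheory Opposite

universe u

noncomputable section

/-! ### Relative singular homology -/

/-- Singular `n`-simplices of `X`, i.e. `n`-simplices of its singular simplicial set. -/
abbrev SingSimplex (X : TopCat.{u}) (n : ℕ) : Type u :=
  (TopCat.toSSet.obj X).obj (op (SimplexCategory.mk n))

/-- The continuous map `Δⁿ → X` underlying a singular simplex. -/
def SingSimplex.toMap {X : TopCat.{u}} {n : ℕ} (σ : SingSimplex X n) :
    C(stdSimplex ℝ (Fin (n + 1)), X) :=
  TopCat.toSSetObjEquiv X (op (SimplexCategory.mk n)) σ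

/-- The `i`-th face of a singular simplex. -/
def SingSimplex.face {X : TopCat.{u}} {n : ℕ} (i : Fin (n + 2)) (σ : SingSimplex X (n + 1)) :
    SingSimplex X n :=
  (TopCat.toSSet.obj X).δ i σ

/-- Singular `n`-chains, as finitely supported functions on singular simplices. -/
abbrev SingChain (X : TopCat.{u}) (n : ℕ) : Type u := SingSimplex X n →₀ ℤ

/-- The singular boundary operator, the alternating sum of the faces. -/
def singBoundary (X : TopCat.{u}) (n : ℕ) : SingChain X (n + 1) →ₗ[ℤ] SingChain X n :=
  ∑ i : Fin (n + 2), (-1 : ℤ) ^ (i : ℕ) • Finsupp.lmapDomain ℤ ℤ (SingSimplex.face i)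

/-- Composition of a singular simplex with a continuous map. -/
def SingSimplex.map {X Y : TopCat.{u}} (f : X ⟶ Y) {n : ℕ} (σ : SingSimplex X n) :
    SingSimplex Y n :=
  (TopCat.toSSet.map f).app (op (SimplexCategory.mk n)) σ

/-- The chain map induced by a continuous map. -/
def singMap {X Y : TopCat.{u}} (f : X ⟶ Y) (n : ℕ) : SingChain X n →ₗ[ℤ] SingChain Y n :=
  Finsupp.lmapDomain ℤ ℤ (SingSimplex.map f)

/-- The free abelian group functor `S ↦ (S →₀ ℤ)`. -/
def freeInt : Type u ⥤ ModuleCat.{u} ℤ where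
  obj S := ModuleCat.of ℤ (S →₀ ℤ)
  map f := ModuleCat.ofHom (Finsupp.lmapDomain ℤ ℤ f)
  map_id S := by
    ext1
    exact Finsupp.lmapDomain_id ℤ ℤ
  map_comp f g := by
    ext1
    exact Finsupp.lmapDomain_comp ℤ ℤ f g

theorem singBoundary_eq (X : TopCat.{u}) (n : ℕ) :
    ModuleCat.ofHom (singBoundary X n) = AlgebraicTopology.AlternatingFaceMapComplex.objD
      (((SimplicialObject.whiskering _ _).obj freeInt).obj (TopCat.toSSet.obj X)) n := by
  have h : ModuleCat.ofHom (singBoundary X n) = ∑ i : Fin (n + 2), (-1 : ℤ) ^ (i : ℕ) •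
      (ModuleCat.ofHom (Finsupp.lmapDomain ℤ ℤ (SingSimplex.face i)) :
        ModuleCat.of ℤ (SingChain X (n + 1)) ⟶ ModuleCat.of ℤ (SingChain X n)) := by
    apply ModuleCat.hom_ext
    rw [ModuleCat.hom_sum]
    rfl
  exact h

theorem singBoundary_comp (X : TopCat.{u}) (n : ℕ) (c : SingChain X (n + 2)) :
    singBoundary X n (singBoundary X (n + 1) c) = 0 := by
  have h := AlgebraicTopology.AlternatingFaceMapComplex.d_squared
    (((SimplicialObject.whiskering _ _).obj freeInt).obj (TopCat.toSSet.obj X)) n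
  rw [← singBoundary_eq, ← singBoundary_eq] at h
  exact congrArg (fun φ => φ.hom c) h

theorem SingSimplex.toMap_map {X Y : TopCat.{u}} (f : X ⟶ Y) {n : ℕ} (σ : SingSimplex X n)
    (t : stdSimplex ℝ (Fin (n + 1))) : (SingSimplex.map f σ).toMap t = f (σ.toMap t) := rfl

theorem SingSimplex.map_face {X Y : TopCat.{u}} (f : X ⟶ Y) {n : ℕ} (i : Fin (n + 2))
    (σ : SingSimplex X (n + 1)) :
    SingSimplex.map f (SingSimplex.face i σ) = SingSimplex.face i (SingSimplex.map f σ) := rfl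

theorem SingSimplex.toMap_face {X : TopCat.{u}} {n : ℕ} (i : Fin (n + 2))
    (σ : SingSimplex X (n + 1)) (t : stdSimplex ℝ (Fin (n + 1))) :
    (SingSimplex.face i σ).toMap t = σ.toMap (stdSimplex.map i.succAbove t) := rfl

theorem singMap_boundary {X Y : TopCat.{u}} (f : X ⟶ Y) (n : ℕ) (c : SingChain X (n + 1)) :
    singBoundary Y n (singMap f (n + 1) c) = singMap f n (singBoundary X n c) := by
  have : singBoundary Y n ∘ₗ singMap f (n + 1) = singMap f n ∘ₗ singBoundary X n := by
    refine Finsupp.lhom_ext fun σ a => ?_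
    simp only [singBoundary, singMap, LinearMap.comp_apply, LinearMap.sum_apply,
      LinearMap.smul_apply, Finsupp.lmapDomain_apply, Finsupp.mapDomain_single, map_sum, map_smul,
      SingSimplex.map_face]
  exact congrArg (fun φ => φ c) this

theorem singMap_id (X : TopCat.{u}) (n : ℕ) (c : SingChain X n) : singMap (𝟙 X) n c = c :=
  Finsupp.mapDomain_id

theorem singMap_comp {X Y Z : TopCat.{u}} (f : X ⟶ Y) (g : Y ⟶ Z) (n : ℕ) (c : SingChain X n) :
    singMap (f ≫ g) n c = singMap g n (singMap f n c) :=
  Finsupp.mapDomain_comp (f := SingSimplex.map f) (g := SingSimplex.map g)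

/-- Chains of `X` all of whose simplices have image in the subset `A`, i.e. the singular chains of
the subspace `A`. -/
def chainsIn (X : TopCat.{u}) (A : Set X) (n : ℕ) : Submodule ℤ (SingChain X n) :=
  Finsupp.supported ℤ ℤ {σ | ∀ t, SingSimplex.toMap σ t ∈ A}

theorem singMap_mem {X Y : TopCat.{u}} (f : X ⟶ Y) {A : Set X} {B : Set Y} (h : Set.MapsTo f A B)
    (n : ℕ) {c : SingChain X n} (hc : c ∈ chainsIn X A n) : singMap f n c ∈ chainsIn Y B n := by
  classical
  intro σ hσ
  obtain ⟨τ, hτ, rfl⟩ := Finset.mem_image.mp (Finsupp.mapDomain_support hσ)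
  intro t
  exact h (hc hτ t)

/-- Relative cycles of the pair `(B, A)` of subspaces of `X`: chains in `B` whose boundary lies
in `A`. -/
def relCycles (X : TopCat.{u}) (B A : Set X) : ∀ n : ℕ, Submodule ℤ (SingChain X n)
  | 0 => chainsIn X B 0
  | n + 1 => chainsIn X B (n + 1) ⊓ (chainsIn X A n).comap (singBoundary X n)

/-- Relative boundaries of the pair `(B, A)`: boundaries of chains in `B`, plus chains in `A`. -/
def relBoundaries (X : TopCat.{u}) (B A : Set X) (n : ℕ) : Submodule ℤ (SingChain X n) :=
  (chainsIn X B (n + 1)).map (singBoundary X n) ⊔ chainsIn X A n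

/-- The relative singular homology group `H_n(B, A; ℤ)` of subspaces `A ⊆ B` of `X`. -/
abbrev RelHomology (X : TopCat.{u}) (B A : Set X) (n : ℕ) : Type u :=
  relCycles X B A n ⧸ (relBoundaries X B A n).comap (relCycles X B A n).subtype

theorem singMap_mem_relCycles {X Y : TopCat.{u}} (f : X ⟶ Y) {B A : Set X} {B' A' : Set Y}
    (hB : Set.MapsTo f B B') (hA : Set.MapsTo f A A') (n : ℕ) :
    ∀ c ∈ relCycles X B A n, singMap f n c ∈ relCycles Y B' A' n := by
  cases n with
  | zero => exact fun c hc => singMap_mem f hB 0 hc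
  | succ n =>
    rintro c ⟨hc, hc'⟩
    refine ⟨singMap_mem f hB _ hc, ?_⟩
    change singBoundary Y n (singMap f (n + 1) c) ∈ chainsIn Y A' n
    rw [singMap_boundary]
    exact singMap_mem f hA n hc'

theorem singMap_mem_relBoundaries {X Y : TopCat.{u}} (f : X ⟶ Y) {B A : Set X} {B' A' : Set Y}
    (hB : Set.MapsTo f B B') (hA : Set.MapsTo f A A') (n : ℕ) :
    ∀ c ∈ relBoundaries X B A n, singMap f n c ∈ relBoundaries Y B' A' n := by
  intro c hc
  rw [relBoundaries, Submodule.mem_sup] at hc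
  obtain ⟨_, ⟨e, he, rfl⟩, a, ha, rfl⟩ := hc
  rw [map_add]
  have h : singMap f n (singBoundary X n e) ∈
      Submodule.map (singBoundary Y n) (chainsIn Y B' (n + 1)) :=
    ⟨singMap f (n + 1) e, singMap_mem f hB _ he, singMap_boundary f n e⟩
  exact Submodule.add_mem_sup h (singMap_mem f hA n ha)

/-- The map on relative homology induced by a map of pairs. -/
def relMap {X Y : TopCat.{u}} (f : X ⟶ Y) {B A : Set X} {B' A' : Set Y}
    (hB : Set.MapsTo f B B') (hA : Set.MapsTo f A A') (n : ℕ) :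
    RelHomology X B A n →ₗ[ℤ] RelHomology Y B' A' n :=
  Submodule.mapQ _ _ ((singMap f n).restrict (singMap_mem_relCycles f hB hA n))
    (fun c hc => singMap_mem_relBoundaries f hB hA n c hc)

theorem singBoundary_mem_relCycles (X : TopCat.{u}) (B A A' : Set X) (n : ℕ) :
    ∀ c ∈ relCycles X B A (n + 1), singBoundary X n c ∈ relCycles X A A' n := by
  cases n with
  | zero => exact fun c hc => hc.2
  | succ n =>
    intro c hc
    refine ⟨hc.2, ?_⟩
    change singBoundary X n (singBoundary X (n + 1) c) ∈ chainsIn X A' n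
    rw [singBoundary_comp]
    exact Submodule.zero_mem _

theorem singBoundary_mem_relBoundaries (X : TopCat.{u}) (B A A' : Set X) (n : ℕ) :
    ∀ c ∈ relBoundaries X B A (n + 1), singBoundary X n c ∈ relBoundaries X A A' n := by
  intro c hc
  rw [relBoundaries, Submodule.mem_sup] at hc
  obtain ⟨_, ⟨e, he, rfl⟩, a, ha, rfl⟩ := hc
  rw [map_add, singBoundary_comp, zero_add]
  have h : singBoundary X n a ∈ Submodule.map (singBoundary X n) (chainsIn X A (n + 1)) :=
    ⟨a, ha, rfl⟩
  exact Submodule.mem_sup_left h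

/-- The connecting homomorphism `H_{n+1}(B, A) → H_n(A, A')` of a triple `A' ⊆ A ⊆ B`. -/
def relBoundary (X : TopCat.{u}) (B A A' : Set X) (n : ℕ) :
    RelHomology X B A (n + 1) →ₗ[ℤ] RelHomology X A A' n :=
  Submodule.mapQ _ _ ((singBoundary X n).restrict (singBoundary_mem_relCycles X B A A' n))
    (fun c hc => singBoundary_mem_relBoundaries X B A A' n c hc)

theorem relBoundary_relBoundary (X : TopCat.{u}) (C B A A' : Set X) (n : ℕ)
    (x : RelHomology X C B (n + 2)) :
    relBoundary X B A A' n (relBoundary X C B A (n + 1) x) = 0 := by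
  obtain ⟨c, rfl⟩ := Submodule.Quotient.mk_surjective _ x
  refine (Submodule.Quotient.mk_eq_zero _).mpr ?_
  change singBoundary X n (singBoundary X (n + 1) c) ∈ relBoundaries X A A' n
  rw [singBoundary_comp]
  exact Submodule.zero_mem _

theorem relMap_relBoundary {X Y : TopCat.{u}} (f : X ⟶ Y) {B A C : Set X} {B' A' C' : Set Y}
    (hB : Set.MapsTo f B B') (hA : Set.MapsTo f A A') (hC : Set.MapsTo f C C') (n : ℕ)
    (x : RelHomology X B A (n + 1)) :
    relBoundary Y B' A' C' n (relMap f hB hA (n + 1) x) =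
      relMap f hA hC n (relBoundary X B A C n x) := by
  obtain ⟨c, rfl⟩ := Submodule.Quotient.mk_surjective _ x
  exact congrArg (Submodule.Quotient.mk) (Subtype.ext (singMap_boundary f n c))

theorem relMap_id {X : TopCat.{u}} (f : X ⟶ X) (hf : f = 𝟙 X) {B A : Set X}
    (hB : Set.MapsTo f B B) (hA : Set.MapsTo f A A) (n : ℕ) (x : RelHomology X B A n) :
    relMap f hB hA n x = x := by
  subst hf
  obtain ⟨c, rfl⟩ := Submodule.Quotient.mk_surjective _ x
  exact congrArg (Submodule.Quotient.mk) (Subtype.ext (singMap_id X n c))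

theorem relMap_comp {X Y Z : TopCat.{u}} (f : X ⟶ Y) (g : Y ⟶ Z) (k : X ⟶ Z) (hk : k = f ≫ g)
    {B A : Set X} {B' A' : Set Y} {B'' A'' : Set Z} (hB : Set.MapsTo f B B')
    (hA : Set.MapsTo f A A') (hB' : Set.MapsTo g B' B'') (hA' : Set.MapsTo g A' A'')
    (hB'' : Set.MapsTo k B B'') (hA'' : Set.MapsTo k A A'')
    (n : ℕ) (x : RelHomology X B A n) :
    relMap k hB'' hA'' n x = relMap g hB' hA' n (relMap f hB hA n x) := by
  subst hk
  obtain ⟨c, rfl⟩ := Submodule.Quotient.mk_surjective _ x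
  exact congrArg (Submodule.Quotient.mk) (Subtype.ext (singMap_comp f g n c))

/-! ### The orbit category and coefficient systems -/

/-- An object of the orbit category of `G`: the orbit `G/K` for a closed subgroup `K` of `G`. -/
structure Orb (G : Type u) [Group G] [TopologicalSpace G] where
  /-- The closed subgroup `K`. -/
  stab : Subgroup G
  isClosed_stab : IsClosed (stab : Set G)

namespace Orb

variable {G : Type u} [Group G] [TopologicalSpace G]

/-- The homogeneous space `G/K`. -/
abbrev space (K : Orb G) : Type u := G ⧸ K.stab

/-- A `G`-map `G/K → G/L`: a continuous equivariant map. -/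
@[ext]
structure Hom (K L : Orb G) where
  /-- The underlying function. -/
  toFun : K.space → L.space
  continuous_toFun : Continuous toFun
  map_smul : ∀ (g : G) (a : K.space), toFun (g • a) = g • toFun a

instance : Category (Orb G) where
  Hom := Hom
  id K := ⟨id, continuous_id, fun _ _ => rfl⟩
  comp f g := ⟨g.toFun ∘ f.toFun, g.continuous_toFun.comp f.continuous_toFun,
    fun a x => by simp [f.map_smul, g.map_smul]⟩

/-- Two `G`-maps of orbits are `G`-homotopic. -/
def Homotopic {K L : Orb G} (f f' : K ⟶ L) : Prop :=
  ∃ h : K.space × unitInterval → L.space, Continuous h ∧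
    (∀ (g : G) (a : K.space) (t : unitInterval), h (g • a, t) = g • h (a, t)) ∧
    (∀ a, h (a, 0) = f.toFun a) ∧ (∀ a, h (a, 1) = f'.toFun a)

/-- The projection `G/H → G/K` for `H ≤ K`. -/
def proj [IsTopologicalGroup G] {H K : Orb G} (h : H.stab ≤ K.stab) : H ⟶ K where
  toFun := Subgroup.quotientMapOfLE h
  continuous_toFun := by
    rw [← QuotientGroup.isOpenQuotientMap_mk.continuous_comp_iff]
    exact QuotientGroup.continuous_mk
  map_smul g a := by
    induction a using QuotientGroup.induction_on with
    | H a => rfl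

end Orb

/-- A coefficient system for `G`: a contravariant functor from orbits and `G`-maps to abelian groups
which takes the same value on `G`-homotopic maps (an automatic condition when `G` is discrete);
equivalently, a contravariant functor on the homotopy category of orbits. -/
structure CoefficientSystem (G : Type u) [Group G] [TopologicalSpace G] where
  /-- The underlying functor. -/
  toFunctor : (Orb G)ᵒᵖ ⥤ AddCommGrpCat.{u}
  map_eq_of_homotopic : ∀ {K L : Orb G} (f f' : K ⟶ L), Orb.Homotopic f f' →
    toFunctor.map f.op = toFunctor.map f'.op

/-- The value `F(G/K)`. -/
abbrev CoefficientSystem.val {G : Type u} [Group G] [TopologicalSpace G] (F : CoefficientSystem G)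
    (K : Orb G) : AddCommGrpCat.{u} := F.toFunctor.obj (op K)

/-- The homomorphism `F(f) : F(G/L) → F(G/K)` induced by a `G`-map `f : G/K → G/L`. -/
def CoefficientSystem.pull {G : Type u} [Group G] [TopologicalSpace G] (F : CoefficientSystem G)
    {K L : Orb G} (f : K ⟶ L) : F.val L →+ F.val K := (F.toFunctor.map f.op).hom

/-! ### `G`-CW complexes and Bredon cohomology -/

section Bredon

variable (G : Type u) [Group G] [TopologicalSpace G]

/-- The closed unit disc `Dⁿ`. -/
abbrev Disc (n : ℕ) : Type := Metric.closedBall (0 : EuclideanSpace ℝ (Fin n)) 1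

/-- A `G`-CW structure on a `G`-space `X`: `X` is built from characteristic `G`-maps
`G/K_e × Dⁿ → X`, which map boundaries into cells of lower dimension, whose restrictions to
interiors decompose `X` as a disjoint union, and which determine the topology of `X` (a set is
closed if all its preimages under characteristic maps are). -/
structure GCWStructure (X : Type u) [TopologicalSpace X] [MulAction G X]
    [ContinuousSMul G X] where
  /-- The index set of the `n`-cells. -/
  cell : ℕ → Type u
  /-- The orbit type of a cell. -/
  orbit : ∀ {n : ℕ}, cell n → Orb G
  /-- The characteristic map of a cell. -/
  char : ∀ {n : ℕ} (e : cell n), (orbit e).space × Disc n → X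
  continuous_char : ∀ {n : ℕ} (e : cell n), Continuous (char e)
  char_smul : ∀ {n : ℕ} (e : cell n) (g : G) (a : (orbit e).space) (v : Disc n),
    char e (g • a, v) = g • char e (a, v)
  boundary : ∀ {n : ℕ} (e : cell n) (a : (orbit e).space) (v : Disc n),
    ‖(v : EuclideanSpace ℝ (Fin n))‖ = 1 → ∃ m < n, ∃ e' : cell m, char e (a, v) ∈ Set.range (char e')
  existsUnique_openCell : ∀ x : X, ∃! p : Σ n : ℕ, Σ e : cell n, (orbit e).space × Disc n,
    ‖(p.2.2.2 : EuclideanSpace ℝ (Fin p.1))‖ < 1 ∧ char p.2.1 p.2.2 = x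
  isClosed_of_char : ∀ A : Set X, (∀ (n : ℕ) (e : cell n), IsClosed (char e ⁻¹' A)) → IsClosed A

variable {G} {X : Type u} [MulAction G X]

/-- For `x` fixed by `K`, the map `G/K → X`, `gK ↦ g x`. -/
def orbitEval {K : Orb G} (x : MulAction.fixedPoints K.stab X) (a : K.space) : X :=
  Quotient.liftOn' a (fun g => g • (x : X)) (by
    intro g g' h
    have hk : g⁻¹ * g' ∈ K.stab := QuotientGroup.leftRel_apply.mp h
    have hx : (g⁻¹ * g') • (x : X) = x := x.2 ⟨_, hk⟩
    rw [mul_smul, inv_smul_eq_iff] at hx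
    exact hx.symm)

theorem orbitEval_mk {K : Orb G} (x : MulAction.fixedPoints K.stab X) (g : G) :
    orbitEval x (QuotientGroup.mk g) = g • (x : X) := rfl

theorem orbitEval_smul {K : Orb G} (x : MulAction.fixedPoints K.stab X) (g : G) (a : K.space) :
    orbitEval x (g • a) = g • orbitEval x a := by
  induction a using QuotientGroup.induction_on with
  | H a => exact mul_smul g a (x : X)

/-- The basepoint `eK` of `G/K`. -/
abbrev Orb.base (K : Orb G) : K.space := QuotientGroup.mk 1

theorem orbitEval_mem {K L : Orb G} (f : K ⟶ L) (x : MulAction.fixedPoints L.stab X) :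
    orbitEval x (f.toFun K.base) ∈ MulAction.fixedPoints K.stab X := by
  rintro ⟨k, hk⟩
  change k • orbitEval x (f.toFun K.base) = _
  rw [← orbitEval_smul, ← f.map_smul]
  congr 2
  exact QuotientGroup.eq.mpr (by simpa using hk)

variable [TopologicalSpace X] [ContinuousSMul G X]

variable (G X) in
/-- The system of fixed point spaces `G/K ↦ X^K` (which is the space of `G`-maps `G/K → X`). A `G`-map
`f : G/K → G/L` with `f(eK) = gL` induces `X^L → X^K`, `x ↦ g x`. -/
def fixedPointSystem : (Orb G)ᵒᵖ ⥤ TopCat.{u} where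
  obj K := TopCat.of (MulAction.fixedPoints K.unop.stab X)
  map f := TopCat.ofHom ⟨fun x => ⟨orbitEval x (f.unop.toFun (Orb.base _)), orbitEval_mem f.unop x⟩,
    by
      refine Continuous.subtype_mk ?_ _
      generalize f.unop.toFun (Orb.base _) = a
      induction a using QuotientGroup.induction_on with
      | H a => exact (continuous_const_smul a).comp continuous_subtype_val⟩
  map_id K := by
    ext x
    exact one_smul G (x.1 : X)
  map_comp {K L M} f f' := by
    ext x
    change orbitEval x (f.unop.toFun (f'.unop.toFun (Orb.base _))) =
      orbitEval ⟨orbitEval x (f.unop.toFun (Orb.base _)), orbitEval_mem f.unop x⟩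
        (f'.unop.toFun (Orb.base _))
    generalize f'.unop.toFun (Orb.base _) = a
    induction a using QuotientGroup.induction_on with
    | H a =>
      rw [orbitEval_mk, ← orbitEval_smul, ← f.unop.map_smul]
      congr 2
      exact congrArg QuotientGroup.mk (mul_one a).symm

namespace GCWStructure

variable (S : GCWStructure G X)

/-- The union of all cells of dimension `< n`, that is, the `(n-1)`-skeleton `X_{n-1}`
(so `X_{-1}` is empty). -/
def skeletonLT (n : ℕ) : Set X := {x | ∃ m < n, ∃ e : S.cell m, x ∈ Set.range (S.char e)}

theorem smul_mem_skeletonLT (n : ℕ) (g : G) {x : X} (hx : x ∈ S.skeletonLT n) :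
    g • x ∈ S.skeletonLT n := by
  obtain ⟨m, hm, e, ⟨a, v⟩, rfl⟩ := hx
  exact ⟨m, hm, e, (g • a, v), S.char_smul e g a v⟩

/-- The subspace `(X_{n-1})^K` of `X^K`. -/
def fixedSkeletonLT (n : ℕ) (K : (Orb G)ᵒᵖ) : Set ((fixedPointSystem G X).obj K) :=
  {x | x.1 ∈ S.skeletonLT n}

theorem mapsTo_fixedSkeletonLT (n : ℕ) {K L : (Orb G)ᵒᵖ} (f : K ⟶ L) :
    Set.MapsTo ((fixedPointSystem G X).map f) (S.fixedSkeletonLT n K) (S.fixedSkeletonLT n L) := by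
  intro x hx
  change orbitEval x (f.unop.toFun (Orb.base _)) ∈ S.skeletonLT n
  generalize f.unop.toFun (Orb.base _) = a
  induction a using QuotientGroup.induction_on with
  | H a => exact S.smul_mem_skeletonLT n a hx

/-- The coefficient system `G/K ↦ H_n((X_n)^K, (X_{n-1})^K; ℤ)` of cellular `n`-chains. -/
def cellularChains (n : ℕ) : (Orb G)ᵒᵖ ⥤ AddCommGrpCat.{u} where
  obj K := AddCommGrpCat.of (RelHomology ((fixedPointSystem G X).obj K)
    (S.fixedSkeletonLT (n + 1) K) (S.fixedSkeletonLT n K) n)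
  map f := AddCommGrpCat.ofHom (relMap ((fixedPointSystem G X).map f)
    (S.mapsTo_fixedSkeletonLT (n + 1) f) (S.mapsTo_fixedSkeletonLT n f) n).toAddMonoidHom
  map_id K := by
    ext x
    exact relMap_id _ ((fixedPointSystem G X).map_id K)
      (S.mapsTo_fixedSkeletonLT (n + 1) _) (S.mapsTo_fixedSkeletonLT n _) n x
  map_comp f g := by
    ext x
    exact relMap_comp _ _ _ ((fixedPointSystem G X).map_comp f g)
      (S.mapsTo_fixedSkeletonLT (n + 1) _) (S.mapsTo_fixedSkeletonLT n _)
      (S.mapsTo_fixedSkeletonLT (n + 1) _) (S.mapsTo_fixedSkeletonLT n _)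
      (S.mapsTo_fixedSkeletonLT (n + 1) _) (S.mapsTo_fixedSkeletonLT n _) n x

/-- The cellular boundary: the connecting homomorphism of the triple of skeleta. -/
def cellularBoundary (n : ℕ) : S.cellularChains (n + 1) ⟶ S.cellularChains n where
  app K := AddCommGrpCat.ofHom (relBoundary ((fixedPointSystem G X).obj K)
    (S.fixedSkeletonLT (n + 2) K) (S.fixedSkeletonLT (n + 1) K)
    (S.fixedSkeletonLT n K) n).toAddMonoidHom
  naturality K L f := by
    ext x
    exact relMap_relBoundary _ (S.mapsTo_fixedSkeletonLT (n + 2) f)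
      (S.mapsTo_fixedSkeletonLT (n + 1) f) (S.mapsTo_fixedSkeletonLT n f) n x

theorem cellularBoundary_comp (n : ℕ) :
    S.cellularBoundary (n + 1) ≫ S.cellularBoundary n = 0 := by
  ext K x
  exact relBoundary_relBoundary _ _ _ _ _ n x

/-- The Bredon cochain complex: `Cⁿ` is the group of natural transformations from the system of
cellular `n`-chains to the coefficient system `F`. -/
def bredonComplex (F : CoefficientSystem G) : CochainComplex AddCommGrpCat.{u} ℕ :=
  CochainComplex.of (fun n => AddCommGrpCat.of (S.cellularChains n ⟶ F.toFunctor))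
    (fun n => AddCommGrpCat.ofHom
      { toFun := fun φ => S.cellularBoundary n ≫ φ
        map_zero' := Limits.comp_zero
        map_add' := fun φ ψ => Preadditive.comp_add _ _ _ _ φ ψ })
    (fun n => by
      apply AddCommGrpCat.hom_ext
      apply AddMonoidHom.ext
      intro φ
      change S.cellularBoundary (n + 1) ≫ S.cellularBoundary n ≫ φ = 0
      rw [← Category.assoc, cellularBoundary_comp, Limits.zero_comp])

/-- The Bredon cohomology group `H_Gⁿ(X; F)` of the `G`-CW complex `X`. -/
def bredonCohomology (F : CoefficientSystem G) (n : ℕ) : AddCommGrpCat.{u} :=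
  (S.bredonComplex F).homology n

end GCWStructure

end Bredon

/-! ### Double mapping cylinders of orbits -/

section Cylinder

variable {G : Type u} [Group G] [TopologicalSpace G] {H K L : Orb G}

/-- The interval `[-1, 1]`. -/
abbrev CylInterval : Type := Set.Icc (-1 : ℝ) 1

/-- The left end of the interval. -/
def cylLeft : CylInterval := ⟨-1, by norm_num⟩

/-- The right end of the interval. -/
def cylRight : CylInterval := ⟨1, by norm_num⟩

/-- The space `G/K ⊔ G/L ⊔ (G/H × [-1, 1])` before gluing. -/
abbrev PreCylinder (H K L : Orb G) : Type u := K.space ⊕ L.space ⊕ (H.space × CylInterval)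

/-- The gluing relation of the double mapping cylinder. -/
inductive CylRel (f : H ⟶ K) (f' : H ⟶ L) : PreCylinder H K L → PreCylinder H K L → Prop
  | left (a : H.space) : CylRel f f' (.inr (.inr (a, cylLeft))) (.inl (f.toFun a))
  | right (a : H.space) : CylRel f f' (.inr (.inr (a, cylRight))) (.inr (.inl (f'.toFun a)))

/-- The double mapping cylinder of `G/K ← G/H → G/L`, with the quotient topology. -/
def DoubleMappingCylinder (f : H ⟶ K) (f' : H ⟶ L) : Type u := Quot (CylRel f f')

namespace DoubleMappingCylinder

variable (f : H ⟶ K) (f' : H ⟶ L)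

instance : TopologicalSpace (DoubleMappingCylinder f f') :=
  inferInstanceAs (TopologicalSpace (Quot _))

/-- The quotient map. -/
def mk (p : PreCylinder H K L) : DoubleMappingCylinder f f' := Quot.mk _ p

/-- The `G`-action on `G/K ⊔ G/L ⊔ (G/H × [-1, 1])`, trivial on the interval. -/
def preSMul (g : G) : PreCylinder H K L → PreCylinder H K L
  | .inl a => .inl (g • a)
  | .inr (.inl a) => .inr (.inl (g • a))
  | .inr (.inr (a, t)) => .inr (.inr (g • a, t))

instance : MulAction G (DoubleMappingCylinder f f') where
  smul g := Quot.map (preSMul g) (by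
    rintro _ _ (a | a)
    · rw [preSMul, preSMul, ← f.map_smul]
      exact .left _
    · rw [preSMul, preSMul, ← f'.map_smul]
      exact .right _)
  one_smul x := by
    induction x using Quot.ind with
    | mk p =>
      refine congrArg (Quot.mk _) ?_
      rcases p with a | a | ⟨a, t⟩ <;> simp [preSMul]
  mul_smul g g' x := by
    induction x using Quot.ind with
    | mk p =>
      refine congrArg (Quot.mk _) ?_
      rcases p with a | a | ⟨a, t⟩ <;> simp [preSMul, mul_smul]

instance [IsTopologicalGroup G] [LocallyCompactSpace G] :
    ContinuousSMul G (DoubleMappingCylinder f f') where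
  continuous_smul := by
    have hq : Topology.IsQuotientMap (mk f f') := isQuotientMap_quot_mk
    refine hq.continuous_lift_prod_right ?_
    have h : Continuous fun p : G × PreCylinder H K L => preSMul p.1 p.2 := by
      let φ : G × PreCylinder H K L ≃ₜ
          (G × K.space) ⊕ (G × L.space) ⊕ (G × (H.space × CylInterval)) :=
        Homeomorph.prodSumDistrib.trans
          ((Homeomorph.refl _).sumCongr Homeomorph.prodSumDistrib)
      have hφ : Continuous fun p => preSMul (φ.symm p).1 (φ.symm p).2 := by
        refine continuous_sum_dom.mpr ⟨?_, continuous_sum_dom.mpr ⟨?_, ?_⟩⟩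
        · exact continuous_inl.comp (continuous_smul (M := G) (X := K.space))
        · exact continuous_inr.comp (continuous_inl.comp (continuous_smul (M := G) (X := L.space)))
        · refine continuous_inr.comp (continuous_inr.comp (Continuous.prodMk ?_ ?_))
          · exact continuous_smul.comp (continuous_fst.prodMk (continuous_fst.comp continuous_snd))
          · exact continuous_snd.comp continuous_snd
      have := hφ.comp φ.continuous
      simpa [Function.comp_def] using this
    exact hq.continuous.comp h

/-- The identification of `D¹` with `[-1, 1]`. -/
def discToInterval (v : Disc 1) : CylInterval :=
  ⟨(v : EuclideanSpace ℝ (Fin 1)) 0, by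
    have h := mem_closedBall_zero_iff.mp v.2
    rw [EuclideanSpace.norm_eq] at h
    simp at h
    exact abs_le.mp h⟩

/-- The inverse identification of `[-1, 1]` with `D¹`. -/
def intervalToDisc (t : CylInterval) : Disc 1 :=
  ⟨!₂[(t : ℝ)], by
    rw [mem_closedBall_zero_iff, EuclideanSpace.norm_eq]
    simpa using abs_le.mpr t.2⟩

theorem continuous_discToInterval : Continuous discToInterval := by
  refine Continuous.subtype_mk ?_ _
  fun_prop

theorem continuous_intervalToDisc : Continuous intervalToDisc := by
  refine Continuous.subtype_mk ?_ _
  refine (PiLp.continuous_toLp 2 _).comp (continuous_pi fun i => ?_)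
  fin_cases i
  exact continuous_subtype_val

theorem discToInterval_intervalToDisc (t : CylInterval) : discToInterval (intervalToDisc t) = t :=
  rfl

theorem intervalToDisc_discToInterval (v : Disc 1) : intervalToDisc (discToInterval v) = v := by
  apply Subtype.ext
  ext i
  fin_cases i
  rfl

theorem norm_disc_one (v : Disc 1) :
    ‖(v : EuclideanSpace ℝ (Fin 1))‖ = |(discToInterval v : ℝ)| := by
  rw [EuclideanSpace.norm_eq]
  simp [discToInterval, Real.sqrt_sq_eq_abs]

/-- The cells: two `0`-cells and one `1`-cell. -/
def Cell : ℕ → Type u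
  | 0 => ULift Bool
  | 1 => PUnit
  | _ + 2 => PEmpty

/-- The orbit types of the cells: `G/K` and `G/L` in dimension `0`, and `G/H` in dimension `1`. -/
def cellOrbit (H K L : Orb G) : ∀ {n : ℕ}, Cell.{u} n → Orb G
  | 0, ⟨false⟩ => K
  | 0, ⟨true⟩ => L
  | 1, _ => H

/-- The characteristic maps of the cells: the inclusions of the two ends, and the quotient map on
`G/H × [-1, 1]`. -/
def cellChar : ∀ {n : ℕ} (e : Cell.{u} n),
    (cellOrbit H K L e).space × Disc n → DoubleMappingCylinder f f'
  | 0, ⟨false⟩, p => mk f f' (.inl p.1)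
  | 0, ⟨true⟩, p => mk f f' (.inr (.inl p.1))
  | 1, _, p => mk f f' (.inr (.inr (p.1, discToInterval p.2)))

/-- The unique open cell containing a point, with its coordinates. -/
def cellCoord : DoubleMappingCylinder f f' →
    Σ n : ℕ, Σ e : Cell.{u} n, (cellOrbit H K L e).space × Disc n :=
  Quot.lift (fun p => match p with
    | .inl a => ⟨0, ⟨false⟩, a, ⟨0, by simp⟩⟩
    | .inr (.inl a) => ⟨0, ⟨true⟩, a, ⟨0, by simp⟩⟩
    | .inr (.inr (a, t)) =>
      open Classical in
      if t = cylLeft then ⟨0, ⟨false⟩, f.toFun a, ⟨0, by simp⟩⟩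
      else if t = cylRight then ⟨0, ⟨true⟩, f'.toFun a, ⟨0, by simp⟩⟩
      else ⟨1, PUnit.unit, a, intervalToDisc t⟩) (by
    have hlr : cylRight ≠ cylLeft := by
      intro h
      have := congrArg Subtype.val h
      norm_num [cylRight, cylLeft] at this
    rintro _ _ (a | a) <;> simp [hlr])

variable [IsTopologicalGroup G] [LocallyCompactSpace G]

/-- The standard `G`-CW structure on the double mapping cylinder of `G/K ← G/H → G/L`, with two
`0`-cells `G/K × D⁰` and `G/L × D⁰` and one `1`-cell `G/H × D¹`. -/
def gcwStructure : GCWStructure G (DoubleMappingCylinder f f') where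
  cell := Cell
  orbit := cellOrbit H K L
  char := cellChar f f'
  continuous_char := by
    have hq : Continuous (mk f f') := continuous_quot_mk
    rintro (_ | _ | n) e
    · rcases e with ⟨_ | _⟩
      · exact hq.comp (continuous_inl.comp continuous_fst)
      · exact hq.comp (continuous_inr.comp (continuous_inl.comp continuous_fst))
    · exact hq.comp (continuous_inr.comp (continuous_inr.comp
        (continuous_id.prodMap continuous_discToInterval)))
    · exact e.elim
  char_smul := by
    rintro (_ | _ | n) e g a v
    · rcases e with ⟨_ | _⟩ <;> rfl
    · rfl
    · exact e.elim
  boundary := by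
    rintro (_ | _ | n) e a v hv
    · exfalso
      rw [Subsingleton.elim (v : EuclideanSpace ℝ (Fin 0)) 0, norm_zero] at hv
      exact zero_ne_one hv
    · refine ⟨0, Nat.one_pos, ?_⟩
      rw [norm_disc_one] at hv
      rcases (abs_eq zero_le_one).mp hv with h | h
      · refine ⟨⟨true⟩, (f'.toFun a, ⟨0, by simp⟩), ?_⟩
        have h' : discToInterval v = cylRight := Subtype.ext h
        change mk f f' _ = mk f f' (.inr (.inr (a, discToInterval v)))
        rw [h']
        exact (Quot.sound (CylRel.right a)).symm
      · refine ⟨⟨false⟩, (f.toFun a, ⟨0, by simp⟩), ?_⟩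
        have h' : discToInterval v = cylLeft := Subtype.ext h
        change mk f f' _ = mk f f' (.inr (.inr (a, discToInterval v)))
        rw [h']
        exact (Quot.sound (CylRel.left a)).symm
    · exact e.elim
  existsUnique_openCell := by
    intro x
    refine ⟨cellCoord f f' x, ?_, ?_⟩
    · induction x using Quot.ind with
      | mk p =>
        rcases p with a | a | ⟨a, t⟩
        · exact ⟨norm_zero.trans_lt one_pos, rfl⟩
        · exact ⟨norm_zero.trans_lt one_pos, rfl⟩
        · by_cases h1 : t = cylLeft
          · subst h1
            have : cellCoord f f' (Quot.mk _ (.inr (.inr (a, cylLeft)))) =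
                ⟨0, ⟨false⟩, f.toFun a, ⟨0, by simp⟩⟩ := by simp [cellCoord]
            rw [this]
            exact ⟨by simp, (Quot.sound (CylRel.left a)).symm⟩
          · by_cases h2 : t = cylRight
            · subst h2
              have : cellCoord f f' (Quot.mk _ (.inr (.inr (a, cylRight)))) =
                  ⟨0, ⟨true⟩, f'.toFun a, ⟨0, by simp⟩⟩ := by simp [cellCoord, h1]
              rw [this]
              exact ⟨by simp, (Quot.sound (CylRel.right a)).symm⟩
            · have : cellCoord f f' (Quot.mk _ (.inr (.inr (a, t)))) =
                  ⟨1, PUnit.unit, a, intervalToDisc t⟩ := by simp [cellCoord, h1, h2]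
              rw [this]
              refine ⟨?_, rfl⟩
              change ‖((intervalToDisc t : Disc 1) : EuclideanSpace ℝ (Fin 1))‖ < 1
              rw [norm_disc_one, discToInterval_intervalToDisc, abs_lt]
              exact ⟨lt_of_le_of_ne t.2.1 fun h => h1 (Subtype.ext h.symm),
                lt_of_le_of_ne t.2.2 fun h => h2 (Subtype.ext h)⟩
    · rintro ⟨n, e, a, v⟩ ⟨hv, rfl⟩
      rcases n with _ | _ | n
      · have hv0 : v = ⟨0, by simp⟩ := Subtype.ext (Subsingleton.elim _ _)
        rcases e with ⟨_ | _⟩ <;> rw [hv0] <;> rfl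
      · change ‖((v : Disc 1) : EuclideanSpace ℝ (Fin 1))‖ < 1 at hv
        rw [norm_disc_one, abs_lt] at hv
        have h1 : discToInterval v ≠ cylLeft := fun h => hv.1.ne' (congrArg Subtype.val h)
        have h2 : discToInterval v ≠ cylRight := fun h => hv.2.ne (congrArg Subtype.val h)
        have : cellCoord f f' (Quot.mk _ (.inr (.inr (a, discToInterval v)))) =
            ⟨1, PUnit.unit, a, intervalToDisc (discToInterval v)⟩ := by
          simp [cellCoord, h1, h2]
        rw [intervalToDisc_discToInterval] at this
        exact this.symm
      · exact e.elim
  isClosed_of_char := by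
    intro A hA
    have hq : Topology.IsQuotientMap (mk f f') := isQuotientMap_quot_mk
    rw [← hq.isClosed_preimage, isClosed_sum_iff, isClosed_sum_iff]
    refine ⟨?_, ?_, ?_⟩
    · exact (hA 0 ⟨false⟩).preimage
        (f := fun a : K.space => (a, (⟨0, by simp⟩ : Disc 0))) (by fun_prop)
    · exact (hA 0 ⟨true⟩).preimage
        (f := fun a : L.space => (a, (⟨0, by simp⟩ : Disc 0))) (by fun_prop)
    · exact (hA 1 PUnit.unit).preimage
        (f := fun p : H.space × CylInterval => (p.1, intervalToDisc p.2))
        (continuous_id.prodMap continuous_intervalToDisc)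

end DoubleMappingCylinder

end Cylinder

end

noncomputable section

open Set Filter Topology

/-! ### Locally constant primitives on simply connected spaces -/

/-! For arbitrary `G`-maps `f : G/H → G/K` and `f' : G/H → G/L`, the Bredon complex of the double
mapping cylinder `X` is identified with `F(G/K) × F(G/L) → F(G/H) → 0`, where the differential sends
`(b, c)` to `F(f')(c) - F(f)(b)`. Its kernel and cokernel are the groups in the theorem.

The identification evaluates a natural transformation on the cells (`evalZeroEquiv`, `evalOneEquiv`)
and is a Yoneda argument. A point `a` of `(G/H)^Γ` is the same as a `G`-map `G/Γ → G/H`, and the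
class of the line `{a} × [-1, 1]` is pulled back along that map from the line over the basepoint.
Evaluation is therefore injective once such lines generate the relative homology, and surjective
once every value extends to a natural singular cochain that kills relative boundaries. In degree `0`
points of the two ends replace lines. In degrees `≥ 2` both skeleta are all of `X` and the chain
groups vanish.

Degree `1` is treated directly on the singular chains of `X^Γ`, without excision. Generation
(`TwoFlows.relCycles_le`): the points of level `< 1/2` flow to the ends in one direction, those of
level `> -1/2` in the other. After subdividing a path, the trajectories push it into the ends, and
the discrepancy where the two flows overlap is a full line. Extension (`jumpCochain`): an element of
`F(G/H)` gives a function `w` on the interior of `X^Γ`, which is constant on paths by the homotopy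
invariance of `F`. The cochain should add up `w` over the crossings of level `0`. Since a path may
cross infinitely often, it is instead defined as the increment of a primitive: a function on the
simplex that is locally constant except for a jump by `w` when the level becomes positive.
Primitives exist because coverings of a simplex have sections (`exists_locallyConstant_sub`). A
primitive on a 2-simplex restricts to its faces, which makes the cochain closed. -/

/-- A locally constant function on the intersection of two open sets covering a simply connected,
locally path-connected space is a difference of locally constant functions on the two sets. -/
theorem exists_locallyConstant_sub {Z M : Type*} [TopologicalSpace Z] [SimplyConnectedSpace Z]
    [LocallyPathConnectedSpace Z] [AddCommGroup M] {P Q : Set Z} (hP : IsOpen P) (hQ : IsOpen Q)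
    (hPQ : ∀ z, z ∈ P ∨ z ∈ Q) (w : Z → M)
    (hw : ∀ z ∈ P, z ∈ Q → ∀ᶠ z' in 𝓝 z, w z' = w z) :
    ∃ p q : Z → M, (∀ z ∈ P, ∀ᶠ z' in 𝓝 z, p z' = p z) ∧ (∀ z ∈ Q, ∀ᶠ z' in 𝓝 z, q z' = q z) ∧
      ∀ z ∈ P, z ∈ Q → q z = p z + w z := by
  classical
  -- With the discrete topology on `M`, continuous maps to `M` are the locally constant ones.
  let _ : TopologicalSpace M := ⊥
  have : DiscreteTopology M := ⟨rfl⟩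
  have hdisc : ∀ m : M, ∀ᶠ m' in 𝓝 m, m' = m := fun m => by
    rw [nhds_discrete]
    exact eventually_pure.mpr rfl
  -- The index `false` stands for `P` and `true` for `Q`. Passing from chart `i` to chart `j` is
  -- translation by `r j - r i`, so that the cocycle condition is a telescoping sum.
  let r : Bool → Z → M := fun i z => if i then w z else 0
  have hrc : ∀ i j z, z ∈ cond i Q P → z ∈ cond j Q P →
      ∀ᶠ z' in 𝓝 z, r j z' - r i z' = r j z - r i z := by
    rintro (_ | _) (_ | _) z hi hj
    · simp [r]
    · filter_upwards [hw z hi hj] with z' h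
      simp [r, h]
    · filter_upwards [hw z hj hi] with z' h
      simp [r, h]
    · simp [r]
  -- The bundle glued from `P × M` and `Q × M` by translation by `w` on the overlap. Its fibre is
  -- discrete, so it is a covering; the coordinates of a section in the two charts are the required
  -- `p` and `q`.
  let C : FiberBundleCore Bool Z M :=
    { baseSet := fun i => cond i Q P
      isOpen_baseSet := by rintro (_ | _) <;> assumption
      indexAt := fun z => decide (z ∉ P)
      mem_baseSet_at := fun z => by
        by_cases h : z ∈ P
        · simp [h]
        · simpa [h] using (hPQ z).resolve_left h
      coordChange := fun i j z m => m + (r j z - r i z)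
      coordChange_self := fun i z _ m => by simp
      continuousOn_coordChange := fun i j => by
        rintro ⟨z, m⟩ ⟨⟨hi, hj⟩, -⟩
        refine ContinuousAt.continuousWithinAt ?_
        have h1 : ∀ᶠ x : Z × M in 𝓝 (z, m), x.2 = m :=
          (continuous_snd.tendsto (z, m)).eventually (hdisc m)
        have h2 : ∀ᶠ x : Z × M in 𝓝 (z, m), r j x.1 - r i x.1 = r j z - r i z :=
          (continuous_fst.tendsto (z, m)).eventually (hrc i j z hi hj)
        refine ContinuousAt.congr (f := fun _ => m + (r j z - r i z)) continuousAt_const ?_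
        filter_upwards [h1, h2] with x hx1 hx2
        rw [hx1, hx2]
      coordChange_comp := fun i j k z _ m => by abel }
  have hcov : IsCoveringMap C.proj := FiberBundle.isCoveringMap (F := M) (E := C.Fiber)
  obtain ⟨z₀⟩ : Nonempty Z := inferInstance
  -- A section is a lift of the identity of `Z`, which exists because `Z` is simply connected and
  -- locally path-connected.
  obtain ⟨S, ⟨-, hS⟩, -⟩ := hcov.existsUnique_continuousMap_lifts (ContinuousMap.id Z) z₀
    (⟨z₀, (0 : M)⟩ : C.TotalSpace) rfl
  have hS' : ∀ z, (S z).1 = z := fun z => congrFun hS z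
  have hloc : ∀ i, ∀ z ∈ cond i Q P,
      ∀ᶠ z' in 𝓝 z, (C.localTriv i (S z')).2 = (C.localTriv i (S z)).2 := by
    intro i z hz
    have hmem : S z ∈ (C.localTriv i).source := by
      rw [C.mem_localTriv_source]
      change (S z).1 ∈ C.baseSet i
      rw [hS']
      exact hz
    have h1 : ContinuousAt (fun z' => (C.localTriv i (S z')).2) z :=
      continuousAt_snd.comp (((C.localTriv i).continuousOn.continuousAt
        ((C.localTriv i).open_source.mem_nhds hmem)).comp S.continuous.continuousAt)
    exact h1.eventually (hdisc _)
  refine ⟨fun z => (C.localTriv false (S z)).2, fun z => (C.localTriv true (S z)).2,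
    hloc false, hloc true, fun z _ _ => ?_⟩
  simp only [C.localTriv_apply]
  have h : ∀ (m m₀ : M) (y : Z), y = z → m + (r true y - m₀) = m + (r false y - m₀) + w z := by
    rintro m m₀ y rfl
    simp only [r]
    simp
    abel
  exact h _ _ _ (hS' z)

/-- `s` is a primitive of the jump `w` across the level `τ = 0`: it is locally constant away from
this level, and jumps by `w` when `τ` becomes positive. -/
def IsJumpPrimitive {Z M : Type*} [TopologicalSpace Z] [AddCommGroup M] (τ : Z → ℝ) (w s : Z → M) :
    Prop :=
  ∀ z, (0 < τ z → ∀ᶠ z' in 𝓝 z, s z' = s z) ∧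
    (τ z ≤ 0 → ∀ᶠ z' in 𝓝 z, s z' = s z + if 0 < τ z' then w z' else 0)

namespace IsJumpPrimitive

variable {Z Z' M M' : Type*} [TopologicalSpace Z] [TopologicalSpace Z'] [AddCommGroup M]
  [AddCommGroup M'] {τ : Z → ℝ} {w s s' : Z → M}

/-- The sets `τ < 1` and `τ > -1` cover `Z` and overlap in the strip where `w` is locally constant.
Writing `w = q - p` there, the primitive is `p` on `τ ≤ 0` and `q` on `τ > 0`. -/
theorem exists_of_continuous [SimplyConnectedSpace Z] [LocallyPathConnectedSpace Z]
    (hτ : Continuous τ) (hw : ∀ z, |τ z| < 1 → ∀ᶠ z' in 𝓝 z, w z' = w z) :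
    ∃ s, IsJumpPrimitive τ w s := by
  obtain ⟨p, q, hp, hq, hpq⟩ := exists_locallyConstant_sub (P := {z | τ z < 1})
    (Q := {z | -1 < τ z}) (isOpen_lt hτ continuous_const) (isOpen_lt continuous_const hτ)
    (fun z => by
      rcases lt_or_ge (τ z) 1 with h | h
      · exact .inl h
      · exact .inr (by change -1 < τ z; linarith)) w
    (fun z h h' => hw z (abs_lt.mpr ⟨h', h⟩))
  refine ⟨fun z => if 0 < τ z then q z else p z, fun z => ⟨fun h => ?_, fun h => ?_⟩⟩
  · have hz : -1 < τ z := by linarith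
    filter_upwards [hq z hz, hτ.continuousAt.eventually (lt_mem_nhds h)] with z' h1 h2
    simp [h, h2, h1]
  · have hz : τ z < 1 := by linarith
    filter_upwards [hp z hz, hτ.continuousAt.eventually (gt_mem_nhds hz)] with z' h1 h2
    by_cases h' : 0 < τ z'
    · have := hpq z' h2 (by change -1 < τ z'; linarith)
      simp [h', not_lt.mpr h, this, h1]
    · simp [h', not_lt.mpr h, h1]

theorem comp (hs : IsJumpPrimitive τ w s) {g : Z' → Z} (hg : Continuous g) :
    IsJumpPrimitive (τ ∘ g) (w ∘ g) (s ∘ g) := fun z =>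
  ⟨fun h => hg.continuousAt.eventually ((hs (g z)).1 h),
    fun h => hg.continuousAt.eventually ((hs (g z)).2 h)⟩

theorem map (hs : IsJumpPrimitive τ w s) (f : M →+ M') :
    IsJumpPrimitive τ (f ∘ w) (f ∘ s) := fun z =>
  ⟨fun h => ((hs z).1 h).mono fun z' h' => congrArg f h',
    fun h => ((hs z).2 h).mono fun z' h' => by
      rw [Function.comp_apply, h', map_add]
      split_ifs <;> simp⟩

/-- The difference of two primitives has no jump left, so it is locally constant. Increments of a
primitive thus depend only on `τ` and `w`. -/
theorem sub_const [PreconnectedSpace Z] (hs : IsJumpPrimitive τ w s) (hs' : IsJumpPrimitive τ w s')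
    (z z' : Z) : s z - s z' = s' z - s' z' := by
  have h : IsLocallyConstant fun z => s z - s' z := by
    rw [IsLocallyConstant.iff_eventually_eq]
    intro z
    rcases lt_or_ge 0 (τ z) with h | h
    · filter_upwards [(hs z).1 h, (hs' z).1 h] with y h1 h2
      rw [h1, h2]
    · filter_upwards [(hs z).2 h, (hs' z).2 h] with y h1 h2
      rw [h1, h2]
      abel
  have : s z - s' z = s z' - s' z' :=
    h.apply_eq_of_isPreconnected isPreconnected_univ (mem_univ z) (mem_univ z')
  rw [sub_eq_sub_iff_add_eq_add] at this ⊢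
  rw [this]
  abel

theorem const_of_ne [PreconnectedSpace Z] (hs : IsJumpPrimitive τ w s) (hτ : Continuous τ)
    (h0 : ∀ z, τ z ≠ 0) (z z' : Z) : s z = s z' := by
  have h : IsLocallyConstant s := by
    rw [IsLocallyConstant.iff_eventually_eq]
    intro z
    rcases lt_or_gt_of_ne (h0 z) with h | h
    · filter_upwards [(hs z).2 h.le, hτ.continuousAt.eventually (gt_mem_nhds h)] with y h1 h2
      rw [h1, if_neg (not_lt.mpr h2.le), add_zero]
    · exact (hs z).1 h
  exact h.apply_eq_of_isPreconnected isPreconnected_univ (mem_univ z) (mem_univ z')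

/-- A constant jump has the obvious primitive. -/
theorem of_const (hτ : Continuous τ) (m : M) (hw : ∀ z, |τ z| < 1 → w z = m) :
    IsJumpPrimitive τ w fun z => if 0 < τ z then m else 0 := fun z =>
  ⟨fun h => (hτ.continuousAt.eventually (lt_mem_nhds h)).mono fun z' h' => by
      simp only [if_pos h, if_pos h'],
    fun h => (hτ.continuousAt.eventually (gt_mem_nhds (h.trans_lt one_pos))).mono fun z' h' => by
      simp only [if_neg (not_lt.mpr h), zero_add]
      split_ifs with h2
      · exact (hw z' (abs_lt.mpr ⟨by linarith, h'⟩)).symm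
      · rfl⟩

end IsJumpPrimitive

/-- Contractibility gives simple connectedness. With local path-connectedness, these are the
conditions under which primitives exist on simplices. -/
instance (n : ℕ) : ContractibleSpace (stdSimplex ℝ (Fin (n + 1))) :=
  (convex_stdSimplex ℝ _).contractibleSpace ⟨_, single_mem_stdSimplex ℝ 0⟩

instance (n : ℕ) : LocallyPathConnectedSpace (stdSimplex ℝ (Fin (n + 1))) :=
  (convex_stdSimplex ℝ _).locallyPathConnectedSpace

/-- A function constant on paths in an open set is locally constant along maps from locally
path-connected spaces. -/
theorem eventually_eq_of_joinedIn {Z Y M : Type*} [TopologicalSpace Z] [TopologicalSpace Y]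
    [LocallyPathConnectedSpace Z] {O : Set Y} (hO : IsOpen O) {w : Y → M}
    (hw : ∀ y y', JoinedIn O y y' → w y = w y') {g : Z → Y} (hg : Continuous g) {z : Z}
    (hz : g z ∈ O) : ∀ᶠ z' in 𝓝 z, w (g z') = w (g z) := by
  obtain ⟨N, ⟨hN, hNc⟩, hNO⟩ := (path_connected_basis z).mem_iff.mp
    ((hO.preimage hg).mem_nhds hz)
  filter_upwards [hN] with z' hz'
  obtain ⟨γ, hγ⟩ := hNc.joinedIn z' hz' z (mem_of_mem_nhds hN)
  exact hw _ _ ⟨γ.map hg, fun t => hNO (hγ t)⟩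

/-! ### The cochain of jumps across a level -/

section Holonomy

variable {Y : TopCat.{u}} {M : Type u} [AddCommGroup M] {τ : Y → ℝ} {w : Y → M}

variable (τ w) in
open Classical in
/-- The total jump of `w` along a singular `1`-simplex when crossing the level `τ = 0`. -/
def jump (σ : SingSimplex Y 1) : M :=
  -- The choice of primitive is immaterial by `IsJumpPrimitive.sub_const`. The default `0` is never
  -- used when `exists_isJumpPrimitive` applies.
  if h : ∃ s, IsJumpPrimitive (τ ∘ σ.toMap) (w ∘ σ.toMap) s then
    h.choose (stdSimplex.vertex 1) - h.choose (stdSimplex.vertex 0) else 0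

theorem jump_eq {σ : SingSimplex Y 1} {s : stdSimplex ℝ (Fin 2) → M}
    (hs : IsJumpPrimitive (τ ∘ σ.toMap) (w ∘ σ.toMap) s) :
    jump τ w σ = s (stdSimplex.vertex 1) - s (stdSimplex.vertex 0) := by
  have h : ∃ s, IsJumpPrimitive (τ ∘ σ.toMap) (w ∘ σ.toMap) s := ⟨s, hs⟩
  rw [jump, dif_pos h]
  exact h.choose_spec.sub_const hs _ _

/-- Constancy of `w` on paths suffices even if `Y` is not locally path-connected: the simplex is, so
`w ∘ σ` becomes locally constant on the strip. -/
theorem exists_isJumpPrimitive (hτ : Continuous τ)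
    (hw : ∀ y y', JoinedIn {y | |τ y| < 1} y y' → w y = w y') {n : ℕ} (σ : SingSimplex Y n) :
    ∃ s, IsJumpPrimitive (τ ∘ σ.toMap) (w ∘ σ.toMap) s :=
  IsJumpPrimitive.exists_of_continuous (hτ.comp σ.toMap.continuous) fun _ hz =>
    eventually_eq_of_joinedIn (isOpen_lt hτ.abs continuous_const) hw σ.toMap.continuous hz

variable (τ w) in
/-- The linear extension of `jump` to singular chains. -/
def jumpChain : SingChain Y 1 →ₗ[ℤ] M := Finsupp.linearCombination ℤ (jump τ w)

theorem jumpChain_single (σ : SingSimplex Y 1) (a : ℤ) :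
    jumpChain τ w (Finsupp.single σ a) = a • jump τ w σ :=
  Finsupp.linearCombination_single ..

theorem singBoundary_single {X : TopCat.{u}} {n : ℕ} (σ : SingSimplex X (n + 1)) (a : ℤ) :
    singBoundary X n (Finsupp.single σ a) =
      ∑ i : Fin (n + 2), (-1 : ℤ) ^ (i : ℕ) • Finsupp.single (SingSimplex.face i σ) a := by
  simp only [singBoundary, LinearMap.sum_apply, LinearMap.smul_apply,
    Finsupp.lmapDomain_apply, Finsupp.mapDomain_single]

/-- A primitive on the whole 2-simplex restricts to a primitive on each face. All three jumps are
then differences of the values of one function at the vertices, and their alternating sum cancels.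
-/
theorem jumpChain_boundary (hτ : Continuous τ)
    (hw : ∀ y y', JoinedIn {y | |τ y| < 1} y y' → w y = w y') (c : SingChain Y 2) :
    jumpChain τ w (singBoundary Y 1 c) = 0 := by
  have : jumpChain τ w ∘ₗ singBoundary Y 1 = 0 := by
    refine Finsupp.lhom_ext fun σ a => ?_
    obtain ⟨s, hs⟩ := exists_isJumpPrimitive hτ hw σ
    have h : ∀ i : Fin 3, jump τ w (SingSimplex.face i σ) =
        s (stdSimplex.vertex (i.succAbove 1)) - s (stdSimplex.vertex (i.succAbove 0)) := by
      intro i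
      have e : ∀ {N : Type u} (f : Y → N),
          f ∘ (SingSimplex.face i σ).toMap = (f ∘ σ.toMap) ∘ stdSimplex.map i.succAbove := fun f =>
        funext fun t => congrArg f (SingSimplex.toMap_face i σ t)
      have e' : τ ∘ (SingSimplex.face i σ).toMap = (τ ∘ σ.toMap) ∘ stdSimplex.map i.succAbove :=
        funext fun t => congrArg τ (SingSimplex.toMap_face i σ t)
      have hs' := hs.comp (stdSimplex.continuous_map i.succAbove)
      rw [← e', ← e] at hs'
      rw [jump_eq hs', Function.comp_apply, Function.comp_apply, stdSimplex.map_vertex,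
        stdSimplex.map_vertex]
    rw [LinearMap.comp_apply, singBoundary_single, LinearMap.zero_apply]
    simp only [map_sum, map_smul, jumpChain_single, h]
    rw [Fin.sum_univ_three, ← smul_comm a, ← smul_comm a, ← smul_comm a, ← smul_add, ← smul_add]
    convert smul_zero a
    change (-1 : ℤ) ^ 0 • (s (stdSimplex.vertex 2) - s (stdSimplex.vertex 1)) +
      (-1 : ℤ) ^ 1 • (s (stdSimplex.vertex 2) - s (stdSimplex.vertex 0)) +
      (-1 : ℤ) ^ 2 • (s (stdSimplex.vertex 1) - s (stdSimplex.vertex 0)) = 0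
    rw [pow_zero, pow_one, neg_one_sq, neg_smul, one_smul, one_smul, one_smul]
    abel
  exact congrArg (fun φ => φ c) this

/-- A simplex in `A` never meets level `0`, so its primitives are constant. -/
theorem jumpChain_eq_zero (hτ : Continuous τ)
    (hw : ∀ y y', JoinedIn {y | |τ y| < 1} y y' → w y = w y') {A : Set Y} (hA : ∀ y ∈ A, τ y ≠ 0)
    {c : SingChain Y 1} (hc : c ∈ chainsIn Y A 1) : jumpChain τ w c = 0 := by
  rw [jumpChain, Finsupp.linearCombination_apply]
  refine Finset.sum_eq_zero fun σ hσ => ?_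
  obtain ⟨s, hs⟩ := exists_isJumpPrimitive hτ hw σ
  change c σ • jump τ w σ = 0
  rw [jump_eq hs, hs.const_of_ne (hτ.comp σ.toMap.continuous) (fun z => hA _ (hc hσ z))
    (stdSimplex.vertex 1) (stdSimplex.vertex 0), sub_self, smul_zero]

end Holonomy

/-! ### Affine singular simplices -/

namespace SingSimplex

/-- The singular simplex with a given underlying map. -/
def ofMap {X : TopCat.{u}} {n : ℕ} (g : C(stdSimplex ℝ (Fin (n + 1)), X)) : SingSimplex X n :=
  (TopCat.toSSetObjEquiv X (op (SimplexCategory.mk n))).symm g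

theorem toMap_ofMap {X : TopCat.{u}} {n : ℕ} (g : C(stdSimplex ℝ (Fin (n + 1)), X)) :
    (ofMap g).toMap = g :=
  (TopCat.toSSetObjEquiv X (op (SimplexCategory.mk n))).apply_symm_apply g

theorem ext_toMap {X : TopCat.{u}} {n : ℕ} {σ σ' : SingSimplex X n}
    (h : ∀ t, σ.toMap t = σ'.toMap t) : σ = σ' :=
  (TopCat.toSSetObjEquiv X (op (SimplexCategory.mk n))).injective (ContinuousMap.ext h)

variable {X Y : TopCat.{u}} {E : Type*} [AddCommGroup E] [Module ℝ E] [TopologicalSpace E]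
  [IsTopologicalAddGroup E] [ContinuousSMul ℝ E]

/-- The composite of `f : E → X` with the affine simplex in `E` with vertices `v`. -/
def affine (f : C(E, X)) {n : ℕ} (v : Fin (n + 1) → E) : SingSimplex X n :=
  ofMap (f.comp ⟨fun t => ∑ i, (t : Fin (n + 1) → ℝ) i • v i, by
    exact continuous_finsetSum _ fun i _ =>
      ((continuous_apply i).comp continuous_subtype_val).smul continuous_const⟩)

theorem toMap_affine (f : C(E, X)) {n : ℕ} (v : Fin (n + 1) → E)
    (t : stdSimplex ℝ (Fin (n + 1))) :
    (affine f v).toMap t = f (∑ i, (t : Fin (n + 1) → ℝ) i • v i) := by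
  rw [affine, toMap_ofMap]
  rfl

theorem face_affine (f : C(E, X)) {n : ℕ} (v : Fin (n + 2) → E) (i : Fin (n + 2)) :
    face i (affine f v) = affine f (v ∘ i.succAbove) := by
  refine ext_toMap fun t => ?_
  rw [toMap_face, toMap_affine, toMap_affine]
  congr 1
  have h : ∀ j, (stdSimplex.map i.succAbove t : Fin (n + 2) → ℝ) j =
      ∑ k with i.succAbove k = j, (t : Fin (n + 1) → ℝ) k := fun j =>
    FunOnFinite.linearMap_apply_apply ℝ ℝ i.succAbove _ j
  have h' : ∑ j, (stdSimplex.map i.succAbove t : Fin (n + 2) → ℝ) j • v j =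
      ∑ k, (t : Fin (n + 1) → ℝ) k • v (i.succAbove k) := by
    simp only [h, Finset.sum_smul]
    -- The barycentric coordinates of the image are sums over the fibres of `succAbove`; regrouping
    -- over the fibres matches the two sides.
    rw [← Finset.sum_fiberwise Finset.univ i.succAbove]
    refine Finset.sum_congr rfl fun j _ => Finset.sum_congr rfl fun k hk => ?_
    rw [(Finset.mem_filter.mp hk).2]
  exact h'

theorem map_affine (f : C(E, X)) {n : ℕ} (v : Fin (n + 1) → E) (g : X ⟶ Y) :
    SingSimplex.map g (affine f v) = affine (g.hom.comp f) v :=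
  ext_toMap fun t => by
    rw [toMap_map, toMap_affine, toMap_affine]
    rfl

theorem toMap_affine_edge (f : C(E, X)) (v₀ v₁ : E) (t : stdSimplex ℝ (Fin 2)) :
    (affine f ![v₀, v₁]).toMap t = f (AffineMap.lineMap v₀ v₁ (t.1 1)) := by
  have h0 : t.1 0 = 1 - t.1 1 := by
    have := stdSimplex.add_eq_one t
    change t.1 0 + t.1 1 = 1 at this
    linarith
  rw [toMap_affine, Fin.sum_univ_two, AffineMap.lineMap_apply_module]
  change f (t.1 0 • v₀ + t.1 1 • v₁) = f ((1 - t.1 1) • v₀ + t.1 1 • v₁)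
  rw [h0]

theorem toMap_affine_mem (f : C(E, X)) {A : Set X} (v₀ v₁ : E) (h : ∀ r : unitInterval,
    f (AffineMap.lineMap v₀ v₁ (r : ℝ)) ∈ A) (t : stdSimplex ℝ (Fin 2)) :
    (affine f ![v₀, v₁]).toMap t ∈ A := by
  rw [toMap_affine_edge]
  exact h ⟨t.1 1, t.2.1 1, stdSimplex.le_one t 1⟩

/-- The chain of the affine edge from `v₀` to `v₁`. -/
def edge (f : C(E, X)) (v₀ v₁ : E) : SingChain X 1 := Finsupp.single (affine f ![v₀, v₁]) 1

/-- The chain of a point. -/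
def point (x : X) : SingChain X 0 := Finsupp.single (ofMap (.const _ x)) 1

theorem affine_zero (f : C(E, X)) (v : Fin 1 → E) : affine f v = ofMap (.const _ (f (v 0))) := by
  refine ext_toMap fun t => ?_
  rw [toMap_affine, toMap_ofMap, Fin.sum_univ_one]
  have : (t : Fin 1 → ℝ) 0 = 1 := by simp
  change f (t.1 0 • v 0) = f (v 0)
  rw [show t.1 0 = 1 from this, one_smul]

theorem singBoundary_edge (f : C(E, X)) (v₀ v₁ : E) :
    singBoundary X 0 (edge f v₀ v₁) = point (f v₁) - point (f v₀) := by
  rw [edge, singBoundary_single, Fin.sum_univ_two, face_affine, face_affine, affine_zero,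
    affine_zero]
  change (-1 : ℤ) ^ 0 • point (f v₁) + (-1 : ℤ) ^ 1 • point (f v₀) = _
  rw [pow_zero, pow_one, one_smul, neg_one_smul, sub_eq_add_neg]

/-- Equality of singular `1`-chains up to boundaries. -/
theorem edge_add_edge (f : C(E, X)) (v₀ v₁ v₂ : E) :
    edge f v₀ v₁ + edge f v₁ v₂ - edge f v₀ v₂ ∈ LinearMap.range (singBoundary X 1) := by
  refine ⟨Finsupp.single (affine f ![v₀, v₁, v₂]) 1, ?_⟩
  rw [singBoundary_single, Fin.sum_univ_three, face_affine, face_affine, face_affine]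
  have h0 : ![v₀, v₁, v₂] ∘ (0 : Fin 3).succAbove = ![v₁, v₂] := by
    ext i; fin_cases i <;> rfl
  have h1 : ![v₀, v₁, v₂] ∘ (1 : Fin 3).succAbove = ![v₀, v₂] := by
    ext i; fin_cases i <;> rfl
  have h2 : ![v₀, v₁, v₂] ∘ (2 : Fin 3).succAbove = ![v₀, v₁] := by
    ext i; fin_cases i <;> rfl
  rw [h0, h1, h2]
  change (-1 : ℤ) ^ 0 • edge f v₁ v₂ + (-1 : ℤ) ^ 1 • edge f v₀ v₂ +
    (-1 : ℤ) ^ 2 • edge f v₀ v₁ = _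
  rw [pow_zero, pow_one, neg_one_sq, neg_smul, one_smul, one_smul, one_smul]
  abel

theorem edge_self (f : C(E, X)) (v : E) : edge f v v ∈ LinearMap.range (singBoundary X 1) := by
  simpa using edge_add_edge f v v v

/-- Opposite pairs of edges of a square. -/
theorem edge_square (f : C(E, X)) (v₀ v₁ v₂ v₃ : E) :
    edge f v₀ v₁ + edge f v₁ v₂ - (edge f v₀ v₃ + edge f v₃ v₂) ∈
      LinearMap.range (singBoundary X 1) := by
  have := sub_mem (edge_add_edge f v₀ v₁ v₂) (edge_add_edge f v₀ v₃ v₂)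
  simpa using this

/-- Affine reparametrizations. -/
theorem edge_congr {E' : Type*} [AddCommGroup E'] [Module ℝ E'] [TopologicalSpace E']
    [IsTopologicalAddGroup E'] [ContinuousSMul ℝ E'] {f : C(E, X)} {f' : C(E', X)} {v₀ v₁ : E}
    {v₀' v₁' : E'} (h : ∀ r : unitInterval,
      f (AffineMap.lineMap v₀ v₁ (r : ℝ)) = f' (AffineMap.lineMap v₀' v₁' (r : ℝ))) :
    edge f v₀ v₁ = edge f' v₀' v₁' := by
  have : affine f ![v₀, v₁] = affine f' ![v₀', v₁'] := by
    refine ext_toMap fun t => ?_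
    rw [toMap_affine_edge, toMap_affine_edge]
    exact h ⟨t.1 1, t.2.1 1, stdSimplex.le_one t 1⟩
  rw [edge, edge, this]

/-- The path of a singular `1`-simplex, extended to the line. -/
def line (σ : SingSimplex X 1) : C(ℝ, X) :=
  σ.toMap.comp ⟨fun r => stdSimplexHomeomorphUnitInterval.symm (projIcc 0 1 zero_le_one r),
    by fun_prop⟩

/-- Every singular 1-simplex is an affine edge in `ℝ`, so that statements about edges of maps `ℝ →
Y` reach all singular 1-chains. -/
theorem affine_line (σ : SingSimplex X 1) : affine σ.line ![0, 1] = σ := by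
  refine ext_toMap fun t => ?_
  rw [toMap_affine, Fin.sum_univ_two]
  have h : (t : Fin 2 → ℝ) 0 • (![0, 1] : Fin 2 → ℝ) 0 + (t : Fin 2 → ℝ) 1 • (![0, 1] : Fin 2 → ℝ) 1
      = (stdSimplexHomeomorphUnitInterval t : ℝ) := by
    simp
    rfl
  rw [h]
  change σ.toMap (stdSimplexHomeomorphUnitInterval.symm (projIcc 0 1 zero_le_one _)) = _
  rw [projIcc_val, Homeomorph.symm_apply_apply]

theorem edge_line (σ : SingSimplex X 1) : edge σ.line 0 1 = Finsupp.single σ 1 := by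
  rw [edge, affine_line]

theorem point_toMap (σ : SingSimplex X 0) : point (σ.toMap (stdSimplex.vertex 0)) =
    Finsupp.single σ 1 := by
  refine congrArg (Finsupp.single · 1) (ext_toMap fun t => ?_)
  rw [toMap_ofMap, ContinuousMap.const_apply, Subsingleton.elim t]

end SingSimplex

/-! ### Generators of the first relative homology of a space with two flows -/

/-- A space `Y` with a level function and two deformations, moving the points of level `< 1/2` and
the points of level `> -1/2` respectively into a subspace `A`, along lines indexed by `J`. -/
structure TwoFlows (Y : TopCat.{u}) (A : Set Y) (J : Type*) where
  /-- The level function. -/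
  level : C(Y, ℝ)
  /-- The deformation decreasing the level. -/
  down : C(Y × ℝ, Y)
  /-- The deformation increasing the level. -/
  up : C(Y × ℝ, Y)
  /-- The lines joining the two ends. -/
  line : J → C(ℝ, Y)
  down_zero : ∀ y, down (y, 0) = y
  up_zero : ∀ y, up (y, 0) = y
  down_mem : ∀ y ∈ A, ∀ r : unitInterval, down (y, r) ∈ A
  up_mem : ∀ y ∈ A, ∀ r : unitInterval, up (y, r) ∈ A
  down_one : ∀ y, level y < 1 / 2 → down (y, 1) ∈ A
  up_one : ∀ y, -(1 / 2) < level y → up (y, 1) ∈ A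
  -- Where both flows apply they run along one line, from the parameter `t` of `y` to the ends `-1`
  -- and `1`.
  exists_line : ∀ y, |level y| < 1 / 2 → ∃ j t, ∀ r : unitInterval,
    down (y, r) = line j (AffineMap.lineMap t (-1 : ℝ) (r : ℝ)) ∧
    up (y, r) = line j (AffineMap.lineMap t (1 : ℝ) (r : ℝ))

namespace TwoFlows

open SingSimplex

variable {Y : TopCat.{u}} {A : Set Y} {J : Type*} (S : TwoFlows Y A J)

/-- The chain of the trajectory of a point under a flow. -/
def trajectory (Φ : C(Y × ℝ, Y)) (y : Y) : SingChain Y 1 :=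
  edge (E := ℝ) (Φ.comp ⟨fun s => (y, s), by fun_prop⟩) 0 1

/-- A chain joining a point to the subspace `A`. -/
def homing (y : Y) : SingChain Y 1 :=
  -- The cutoff `0` is one choice inside the strip `|level| < 1/2`, where the two trajectories agree
  -- modulo lines.
  if S.level y ≤ 0 then trajectory S.down y else trajectory S.up y

/-- The linear extension of `homing`. -/
def homingChain : SingChain Y 0 →ₗ[ℤ] SingChain Y 1 :=
  Finsupp.linearCombination ℤ fun σ => S.homing (σ.toMap (stdSimplex.vertex 0))

theorem homingChain_point (y : Y) : S.homingChain (point y) = S.homing y := by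
  rw [homingChain, point, Finsupp.linearCombination_single, one_smul, toMap_ofMap]
  rfl

/-- The span of the lines, modulo boundaries and chains in `A`. -/
def lineSpan : Submodule ℤ (SingChain Y 1) :=
  relBoundaries Y univ A 1 ⊔ Submodule.span ℤ (range fun j => edge (S.line j) (-1) 1)

theorem chainsIn_univ (X : TopCat.{u}) (n : ℕ) : chainsIn X univ n = ⊤ := by
  rw [chainsIn]
  simp

theorem mem_lineSpan_of_boundary {c : SingChain Y 1}
    (hc : c ∈ LinearMap.range (singBoundary Y 1)) : c ∈ S.lineSpan := by
  refine Submodule.mem_sup_left (Submodule.mem_sup_left ?_)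
  rw [chainsIn_univ]
  obtain ⟨b, rfl⟩ := hc
  exact ⟨b, trivial, rfl⟩

theorem mem_lineSpan_of_chainsIn {c : SingChain Y 1} (hc : c ∈ chainsIn Y A 1) :
    c ∈ S.lineSpan :=
  Submodule.mem_sup_left (Submodule.mem_sup_right hc)

theorem edge_mem_chainsIn {E : Type*} [AddCommGroup E] [Module ℝ E] [TopologicalSpace E]
    [IsTopologicalAddGroup E] [ContinuousSMul ℝ E] (f : C(E, Y)) (v₀ v₁ : E)
    (h : ∀ r : unitInterval, f (AffineMap.lineMap v₀ v₁ (r : ℝ)) ∈ A) :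
    edge f v₀ v₁ ∈ chainsIn Y A 1 :=
  Finsupp.single_mem_supported ℤ 1 (toMap_affine_mem f v₀ v₁ h)

theorem trajectory_mem {Φ : C(Y × ℝ, Y)} {y : Y} (h : ∀ r : unitInterval, Φ (y, r) ∈ A) :
    trajectory Φ y ∈ chainsIn Y A 1 :=
  edge_mem_chainsIn _ _ _ fun r => by
    have := h r
    simpa [AffineMap.lineMap_apply] using this

theorem homing_mem {y : Y} (hy : y ∈ A) : S.homing y ∈ chainsIn Y A 1 := by
  rw [homing]
  split_ifs
  · exact trajectory_mem (S.down_mem y hy)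
  · exact trajectory_mem (S.up_mem y hy)

/-- Both trajectories are edges of the same line starting at `t`. By the triangle `t, -1, 1`, their
difference is minus the full line up to a boundary. -/
theorem down_sub_up {y : Y} (hy : |S.level y| < 1 / 2) :
    trajectory S.down y - trajectory S.up y ∈ S.lineSpan := by
  obtain ⟨j, t, h⟩ := S.exists_line y hy
  have hd : trajectory S.down y = edge (S.line j) t (-1) := edge_congr fun r => by
    have := (h r).1
    simpa [AffineMap.lineMap_apply] using this
  have hu : trajectory S.up y = edge (S.line j) t 1 := edge_congr fun r => by
    have := (h r).2
    simpa [AffineMap.lineMap_apply] using this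
  rw [hd, hu]
  have h1 : edge (S.line j) (-1) 1 ∈ S.lineSpan :=
    Submodule.mem_sup_right (Submodule.subset_span ⟨j, rfl⟩)
  have h2 := S.mem_lineSpan_of_boundary (edge_add_edge (S.line j) t (-1) 1)
  convert sub_mem h2 h1 using 1
  abel

/-- Modulo lines, the piecewise choice in `homing` may be replaced by a single flow throughout its
domain. This keeps `homing` usable along segments that cross the cutoff. -/
theorem homing_sub_down {y : Y} (hy : S.level y < 1 / 2) :
    S.homing y - trajectory S.down y ∈ S.lineSpan := by
  rw [homing]
  split_ifs with h
  · simp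
  · rw [← neg_sub]
    exact neg_mem (S.down_sub_up (abs_lt.mpr ⟨by linarith, hy⟩))

theorem homing_sub_up {y : Y} (hy : -(1 / 2) < S.level y) :
    S.homing y - trajectory S.up y ∈ S.lineSpan := by
  rw [homing]
  split_ifs with h
  · exact S.down_sub_up (abs_lt.mpr ⟨hy, by linarith⟩)
  · simp

/-- The square `(s, r) ↦ Φ (f s, r)` has `f` as bottom edge, trajectories as sides and a top edge in
`A`; the two ways around it differ by a boundary. -/
theorem edge_add_trajectory (Φ : C(Y × ℝ, Y)) (h0 : ∀ y, Φ (y, 0) = y) (f : C(ℝ, Y)) (a b : ℝ)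
    (h1 : ∀ r : unitInterval, Φ (f (AffineMap.lineMap a b (r : ℝ)), 1) ∈ A) :
    edge f a b + trajectory Φ (f b) - trajectory Φ (f a) ∈ S.lineSpan := by
  let F : C(ℝ × ℝ, Y) := Φ.comp (f.prodMap (.id ℝ))
  have e1 : edge F (a, 0) (b, 0) = edge f a b := edge_congr fun r => by
    rw [AffineMap.lineMap_apply_module, AffineMap.lineMap_apply_module]
    simp [F, h0]
  have e2 : edge F (b, 0) (b, 1) = trajectory Φ (f b) := edge_congr fun r => by
    rw [AffineMap.lineMap_apply_module, AffineMap.lineMap_apply_module]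
    simp [F, ← add_mul]
  have e3 : edge F (a, 0) (a, 1) = trajectory Φ (f a) := edge_congr fun r => by
    rw [AffineMap.lineMap_apply_module, AffineMap.lineMap_apply_module]
    simp [F, ← add_mul]
  have e4 : edge F (a, 1) (b, 1) ∈ chainsIn Y A 1 := edge_mem_chainsIn _ _ _ fun r => by
    have := h1 r
    rw [AffineMap.lineMap_apply_module] at this ⊢
    simpa [F] using this
  have := add_mem (S.mem_lineSpan_of_boundary (edge_square F (a, 0) (b, 0) (b, 1) (a, 1)))
    (S.mem_lineSpan_of_chainsIn e4)
  rw [e1, e2, e3] at this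
  convert this using 1
  abel

theorem edge_add_homing_of_lt (f : C(ℝ, Y)) (a b : ℝ)
    (h : ∀ r : unitInterval, S.level (f (AffineMap.lineMap a b (r : ℝ))) < 1 / 2) :
    edge f a b + S.homing (f b) - S.homing (f a) ∈ S.lineSpan := by
  have h1 := S.edge_add_trajectory S.down S.down_zero f a b fun r => S.down_one _ (h r)
  have ha := S.homing_sub_down (y := f a) (by simpa using h 0)
  have hb := S.homing_sub_down (y := f b) (by simpa using h 1)
  convert sub_mem (add_mem h1 hb) ha using 1
  abel

theorem edge_add_homing_of_gt (f : C(ℝ, Y)) (a b : ℝ)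
    (h : ∀ r : unitInterval, -(1 / 2) < S.level (f (AffineMap.lineMap a b (r : ℝ)))) :
    edge f a b + S.homing (f b) - S.homing (f a) ∈ S.lineSpan := by
  have h1 := S.edge_add_trajectory S.up S.up_zero f a b fun r => S.up_one _ (h r)
  have ha := S.homing_sub_up (y := f a) (by simpa using h 0)
  have hb := S.homing_sub_up (y := f b) (by simpa using h 1)
  convert sub_mem (add_mem h1 hb) ha using 1
  abel

/-- By compactness, `[0, 1]` is cut into segments on which the level stays below `1/2` or above
`-1/2`. One flow handles each segment, and the `homing` terms at the intermediate points telescope.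
-/
theorem edge_add_homing (f : C(ℝ, Y)) :
    edge f (0 : ℝ) 1 + S.homing (f 1) - S.homing (f 0) ∈ S.lineSpan := by
  let g : C(unitInterval, ℝ) := (S.level.comp f).comp ⟨Subtype.val, continuous_subtype_val⟩
  -- The index `true` is the low region, `false` the high one.
  let c : Bool → Set unitInterval := fun i => cond i {r | g r < 1 / 2} {r | -(1 / 2) < g r}
  have hc : ∀ i, IsOpen (c i) := by
    rintro (_ | _)
    · exact isOpen_lt continuous_const g.continuous
    · exact isOpen_lt g.continuous continuous_const
  have hc' : univ ⊆ ⋃ i, c i := fun r _ => by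
    rcases lt_or_ge (g r) (1 / 2) with h | h
    · exact mem_iUnion.mpr ⟨true, h⟩
    · exact mem_iUnion.mpr ⟨false, show -(1 / 2) < g r by linarith⟩
  obtain ⟨t, ht0, htm, ⟨n, hn⟩, htc⟩ := exists_monotone_Icc_subset_open_cover_unitInterval hc hc'
  have key : ∀ m, edge f (0 : ℝ) (t m) + S.homing (f (t m)) - S.homing (f 0) ∈ S.lineSpan := by
    intro m
    induction m with
    | zero =>
      rw [ht0]
      simpa using S.mem_lineSpan_of_boundary (edge_self f (0 : ℝ))
    | succ m ih =>
      have hseg : ∀ r : unitInterval, ∃ x ∈ Icc (t m) (t (m + 1)),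
          (x : ℝ) = AffineMap.lineMap (t m : ℝ) (t (m + 1) : ℝ) (r : ℝ) := by
        intro r
        have hle : (t m : ℝ) ≤ t (m + 1) := htm m.le_succ
        have h1 : (t m : ℝ) ≤ AffineMap.lineMap (t m : ℝ) (t (m + 1) : ℝ) (r : ℝ) := by
          rw [AffineMap.lineMap_apply_ring]
          nlinarith [r.2.1]
        have h2 : AffineMap.lineMap (t m : ℝ) (t (m + 1) : ℝ) (r : ℝ) ≤ (t (m + 1) : ℝ) := by
          rw [AffineMap.lineMap_apply_ring]
          nlinarith [r.2.2]
        exact ⟨⟨_, (t m).2.1.trans h1, h2.trans (t (m + 1)).2.2⟩, ⟨h1, h2⟩, rfl⟩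
      have hstep : edge f (t m : ℝ) (t (m + 1)) + S.homing (f (t (m + 1))) - S.homing (f (t m)) ∈
          S.lineSpan := by
        obtain ⟨_ | _, hi⟩ := htc m
        · refine S.edge_add_homing_of_gt f _ _ fun r => ?_
          obtain ⟨x, hx, hx'⟩ := hseg r
          rw [← hx']
          exact hi hx
        · refine S.edge_add_homing_of_lt f _ _ fun r => ?_
          obtain ⟨x, hx, hx'⟩ := hseg r
          rw [← hx']
          exact hi hx
      have hadd := S.mem_lineSpan_of_boundary (edge_add_edge f (0 : ℝ) (t m) (t (m + 1)))
      convert sub_mem (add_mem ih hstep) hadd using 1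
      abel
  simpa [hn n le_rfl] using key n

/-- `homingChain` serves as a chain homotopy showing that 1-chains vanish modulo lines, up to a term
depending on the boundary alone. -/
theorem add_homingChain_boundary (c : SingChain Y 1) :
    c + S.homingChain (singBoundary Y 0 c) ∈ S.lineSpan := by
  induction c using Finsupp.induction_linear with
  | zero => simp
  | add c c' h h' =>
    rw [map_add, map_add]
    convert add_mem h h' using 1
    abel
  | single σ a =>
    have h := S.edge_add_homing σ.line
    rw [add_sub_assoc, ← S.homingChain_point, ← S.homingChain_point, ← map_sub,
      ← singBoundary_edge, edge_line] at h
    have := S.lineSpan.smul_mem a h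
    rw [smul_add, ← map_smul, ← map_smul, Finsupp.smul_single, smul_eq_mul, mul_one] at this
    exact this

theorem homingChain_mem {c : SingChain Y 0} (hc : c ∈ chainsIn Y A 0) :
    S.homingChain c ∈ chainsIn Y A 1 := by
  rw [homingChain, Finsupp.linearCombination_apply]
  exact sum_mem fun σ hσ => Submodule.smul_mem _ _ (S.homing_mem (hc hσ _))

/-- Relative `1`-cycles are generated by the lines. -/
theorem relCycles_le : relCycles Y univ A 1 ≤ S.lineSpan := fun c hc => by
  -- The boundary of a relative cycle lies in `A`, and the flows keep points of `A` in `A`, so the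
  -- correction term is itself a chain in `A`.
  have h := S.mem_lineSpan_of_chainsIn (S.homingChain_mem hc.2)
  simpa using sub_mem (S.add_homingChain_boundary c) h

end TwoFlows

/-- Equivariance is required only at `x`, which allows maps such as `toMid` that are equivariant
only on part of the cylinder. -/
theorem MulAction.mem_fixedPoints_of_smul {G X Z : Type*} [Group G] [MulAction G X] [MulAction G Z] {Γ : Subgroup G}
    {r : X → Z} {x : X} (hr : ∀ g : G, r (g • x) = g • r x) (hx : x ∈ MulAction.fixedPoints Γ X) :
    r x ∈ MulAction.fixedPoints Γ Z := fun g => by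
  have h := hr g
  rw [show (g : G) • x = x from hx g] at h
  exact h.symm

/-! ### Maps out of orbits -/

namespace Orb

variable {G : Type u} [Group G] [TopologicalSpace G] {J K L : Orb G}

theorem base_mem_fixedPoints (K : Orb G) : K.base ∈ MulAction.fixedPoints K.stab K.space := by
  rintro ⟨k, hk⟩
  exact QuotientGroup.eq.mpr (by simpa using hk)

theorem hom_ext_base {f g : K ⟶ L} (h : f.toFun K.base = g.toFun K.base) : f = g := by
  refine Hom.ext (funext fun a => ?_)
  induction a using QuotientGroup.induction_on with
  | H a =>
    have : (QuotientGroup.mk a : K.space) = a • K.base :=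
      congrArg QuotientGroup.mk (mul_one a).symm
    rw [this, f.map_smul, g.map_smul, h]

theorem exists_rep (h : J ⟶ K) : ∃ g : G, h.toFun J.base = QuotientGroup.mk g :=
  (QuotientGroup.mk_surjective _).imp fun _ => Eq.symm

variable [IsTopologicalGroup G]

/-- The `G`-map `G/K → G/L` sending the basepoint to a given point fixed by `K`. -/
def ofFixed (x : MulAction.fixedPoints K.stab L.space) : K ⟶ L where
  toFun := orbitEval x
  continuous_toFun := by
    rw [← QuotientGroup.isOpenQuotientMap_mk.continuous_comp_iff]
    exact continuous_id.smul continuous_const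
  map_smul := orbitEval_smul x

theorem ofFixed_base (x : MulAction.fixedPoints K.stab L.space) :
    (ofFixed x).toFun K.base = x := one_smul G x.1

theorem comp_ofFixed (f : J ⟶ K) (x : MulAction.fixedPoints K.stab L.space) :
    f ≫ ofFixed x = ofFixed ⟨orbitEval x (f.toFun J.base), orbitEval_mem f x⟩ :=
  hom_ext_base (ofFixed_base (K := J) (L := L) ⟨_, orbitEval_mem f x⟩).symm

/-- A path `γ` of `K`-fixed points gives the homotopy `(gK, t) ↦ g • γ t`. -/
theorem homotopic_ofFixed {x y : L.space} (hx : x ∈ MulAction.fixedPoints K.stab L.space)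
    (hy : y ∈ MulAction.fixedPoints K.stab L.space)
    (h : JoinedIn (MulAction.fixedPoints K.stab L.space) x y) :
    Homotopic (ofFixed ⟨x, hx⟩) (ofFixed ⟨y, hy⟩) := by
  obtain ⟨γ, hγ⟩ := h
  refine ⟨fun p => orbitEval ⟨γ p.2, hγ p.2⟩ p.1, ?_, fun g a t => orbitEval_smul _ g a,
    fun a => ?_, fun a => ?_⟩
  · rw [← (QuotientGroup.isOpenQuotientMap_mk.prodMap IsOpenQuotientMap.id).continuous_comp_iff]
    exact continuous_fst.smul (γ.continuous.comp continuous_snd)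
  · change orbitEval ⟨γ 0, hγ 0⟩ a = orbitEval ⟨x, hx⟩ a
    congr 2
    exact γ.source
  · change orbitEval ⟨γ 1, hγ 1⟩ a = orbitEval ⟨y, hy⟩ a
    congr 2
    exact γ.target

end Orb

/-! ### Evaluation of coefficient systems at fixed points of orbits -/

namespace CoefficientSystem

variable {G : Type u} [Group G] [TopologicalSpace G] (F : CoefficientSystem G) {J K L : Orb G}

theorem pull_comp (f : J ⟶ K) (g : K ⟶ L) (a : F.val L) :
    F.pull (f ≫ g) a = F.pull f (F.pull g a) := by
  rw [pull, op_comp, F.toFunctor.map_comp]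
  rfl

theorem pull_id (a : F.val K) : F.pull (𝟙 K) a = a := by
  rw [pull, op_id, F.toFunctor.map_id]
  rfl

variable [IsTopologicalGroup G]

open Classical in
/-- The restriction of `a ∈ F(G/L)` along the `G`-map `G/K → G/L` given by a point of `(G/L)^K`. -/
def evalAt (a : F.val L) (K : Orb G) (x : L.space) : F.val K :=
  if h : x ∈ MulAction.fixedPoints K.stab L.space then F.pull (Orb.ofFixed ⟨x, h⟩) a else 0

theorem evalAt_of_mem (a : F.val L) {x : L.space} (h : x ∈ MulAction.fixedPoints K.stab L.space) :
    F.evalAt a K x = F.pull (Orb.ofFixed ⟨x, h⟩) a := dif_pos h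

theorem evalAt_base (a : F.val L) : F.evalAt a L L.base = a := by
  rw [F.evalAt_of_mem a L.base_mem_fixedPoints]
  have : Orb.ofFixed ⟨L.base, L.base_mem_fixedPoints⟩ = 𝟙 L :=
    Orb.hom_ext_base (Orb.ofFixed_base (K := L) (L := L) _)
  rw [this, pull_id]

/-- This is where the homotopy invariance of the coefficient system enters. -/
theorem evalAt_eq_of_joinedIn (a : F.val L) {x y : L.space}
    (h : JoinedIn (MulAction.fixedPoints K.stab L.space) x y) :
    F.evalAt a K x = F.evalAt a K y := by
  rw [F.evalAt_of_mem a h.source_mem, F.evalAt_of_mem a h.target_mem, pull, pull,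
    F.map_eq_of_homotopic _ _ (Orb.homotopic_ofFixed h.source_mem h.target_mem h)]

/-- Naturality in terms of a representative `g` of `f(eJ)`: composing `f` with the `G`-map that
classifies `x` gives the one that classifies `g • x`. -/
theorem pull_evalAt (f : J ⟶ K) (a : F.val L) {g : G} (hg : f.toFun J.base = QuotientGroup.mk g)
    {x : L.space} (h : x ∈ MulAction.fixedPoints K.stab L.space) :
    F.pull f (F.evalAt a K x) = F.evalAt a J (g • x) := by
  have hx : orbitEval ⟨x, h⟩ (f.toFun J.base) = g • x := by
    rw [hg]
    rfl
  have h' : g • x ∈ MulAction.fixedPoints J.stab L.space := hx ▸ orbitEval_mem f ⟨x, h⟩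
  rw [F.evalAt_of_mem a h, F.evalAt_of_mem a h', ← pull_comp, Orb.comp_ofFixed]
  exact congrArg (fun y : MulAction.fixedPoints J.stab L.space => F.pull (Orb.ofFixed y) a)
    (Subtype.ext hx)

end CoefficientSystem

/-! ### The geometry of the double mapping cylinder -/

namespace DoubleMappingCylinder

variable {G : Type u} [Group G] [TopologicalSpace G] {H K L : Orb G} (f : H ⟶ K) (f' : H ⟶ L)

theorem cylRight_ne_cylLeft : cylRight ≠ cylLeft := fun h => by
  have := congrArg Subtype.val h
  norm_num [cylRight, cylLeft] at this

theorem isQuotientMap_mk : IsQuotientMap (mk f f') := isQuotientMap_quot_mk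

variable {f f'} in
theorem ind {motive : DoubleMappingCylinder f f' → Prop} (left : ∀ a, motive (mk f f' (.inl a)))
    (right : ∀ a, motive (mk f f' (.inr (.inl a))))
    (mid : ∀ a t, motive (mk f f' (.inr (.inr (a, t))))) (x) : motive x := by
  induction x using Quot.ind with
  | mk p => rcases p with a | a | ⟨a, t⟩ <;> solve_by_elim

theorem mk_left (a : H.space) : mk f f' (.inr (.inr (a, cylLeft))) = mk f f' (.inl (f.toFun a)) :=
  Quot.sound (.left a)

theorem mk_right (a : H.space) :
    mk f f' (.inr (.inr (a, cylRight))) = mk f f' (.inr (.inl (f'.toFun a))) :=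
  Quot.sound (.right a)

theorem smul_mk (g : G) (p : PreCylinder H K L) : g • mk f f' p = mk f f' (preSMul g p) := rfl

/-- The coordinate in `[-1, 1]`. -/
def level : DoubleMappingCylinder f f' → ℝ :=
  Quot.lift (fun p => match p with
    | .inl _ => -1
    | .inr (.inl _) => 1
    | .inr (.inr (_, t)) => t) (by rintro _ _ (a | a) <;> rfl)

theorem continuous_level : Continuous (level f f') := by
  rw [(isQuotientMap_mk f f').continuous_iff]
  refine continuous_sum_dom.mpr ⟨continuous_const, continuous_sum_dom.mpr ⟨continuous_const, ?_⟩⟩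
  exact continuous_subtype_val.comp continuous_snd

theorem level_smul (g : G) (x : DoubleMappingCylinder f f') : level f f' (g • x) = level f f' x := by
  induction x using ind <;> rfl

open Classical in
/-- The coordinate in `G/H` of a point away from the ends. -/
def toMid : DoubleMappingCylinder f f' → H.space :=
  Quot.lift (fun p => match p with
    | .inl _ => H.base
    | .inr (.inl _) => H.base
    -- At the ends the gluing forgets `a`, so a constant default is needed there for the lift to be
    -- well defined.
    | .inr (.inr (a, t)) => if t = cylLeft ∨ t = cylRight then H.base else a)
    (by rintro _ _ (a | a) <;> simp)

open Classical in
/-- The projection to the left end. -/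
def toLeft : DoubleMappingCylinder f f' → K.space :=
  Quot.lift (fun p => match p with
    | .inl a => a
    | .inr (.inl _) => K.base
    | .inr (.inr (a, t)) => if t = cylRight then K.base else f.toFun a)
    (by rintro _ _ (a | a) <;> simp [cylRight_ne_cylLeft.symm])

open Classical in
/-- The projection to the right end. -/
def toRight : DoubleMappingCylinder f f' → L.space :=
  Quot.lift (fun p => match p with
    | .inl _ => L.base
    | .inr (.inl a) => a
    | .inr (.inr (a, t)) => if t = cylLeft then L.base else f'.toFun a)
    (by rintro _ _ (a | a) <;> simp [cylRight_ne_cylLeft])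

theorem toMid_mk {a : H.space} {t : CylInterval} (ht : |(t : ℝ)| < 1) :
    toMid f f' (mk f f' (.inr (.inr (a, t)))) = a := by
  refine if_neg ?_
  rintro (rfl | rfl) <;> norm_num [cylLeft, cylRight] at ht

theorem toLeft_mk {a : H.space} {t : CylInterval} (ht : (t : ℝ) < 1) :
    toLeft f f' (mk f f' (.inr (.inr (a, t)))) = f.toFun a := by
  refine if_neg ?_
  rintro rfl
  norm_num [cylRight] at ht

theorem toRight_mk {a : H.space} {t : CylInterval} (ht : -1 < (t : ℝ)) :
    toRight f f' (mk f f' (.inr (.inr (a, t)))) = f'.toFun a := by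
  refine if_neg ?_
  rintro rfl
  norm_num [cylLeft] at ht

theorem toMid_smul (g : G) {x : DoubleMappingCylinder f f'} (hx : |level f f' x| < 1) :
    toMid f f' (g • x) = g • toMid f f' x := by
  induction x using ind with
  | left a => norm_num [level, mk] at hx
  | right a => norm_num [level, mk] at hx
  | mid a t => rw [toMid_mk f f' hx, smul_mk, preSMul, toMid_mk f f' hx]

theorem toLeft_smul (g : G) {x : DoubleMappingCylinder f f'} (hx : level f f' x < 1) :
    toLeft f f' (g • x) = g • toLeft f f' x := by
  induction x using ind with
  | left a => rfl
  | right a => norm_num [level, mk] at hx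
  | mid a t => rw [toLeft_mk f f' hx, smul_mk, preSMul, toLeft_mk f f' hx, f.map_smul]

theorem toRight_smul (g : G) {x : DoubleMappingCylinder f f'} (hx : -1 < level f f' x) :
    toRight f f' (g • x) = g • toRight f f' x := by
  induction x using ind with
  | left a => norm_num [level, mk] at hx
  | right a => rfl
  | mid a t => rw [toRight_mk f f' hx, smul_mk, preSMul, toRight_mk f f' hx, f'.map_smul]

/-- Over an open set, continuity can be tested after composing with the quotient map. On the
preimage the map is the first projection of `G/H × (-1, 1)`. -/
theorem continuousOn_toMid : ContinuousOn (toMid f f') {x | |level f f' x| < 1} := by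
  rw [(isQuotientMap_mk f f').continuousOn_isOpen_iff
    (isOpen_lt (continuous_level f f').abs continuous_const)]
  rintro (a | a | ⟨a, t⟩) hx
  · norm_num [level, mk] at hx
  · norm_num [level, mk] at hx
  · refine ContinuousAt.continuousWithinAt ?_
    rw [IsOpenEmbedding.inr.continuousAt_iff.symm, IsOpenEmbedding.inr.continuousAt_iff.symm]
    refine continuousAt_fst.congr ?_
    have ho : IsOpen {p : H.space × CylInterval | |(p.2 : ℝ)| < 1} :=
      isOpen_lt (continuous_subtype_val.comp continuous_snd).abs continuous_const
    filter_upwards [ho.mem_nhds hx] with p hp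
    exact (toMid_mk f f' hp).symm

theorem continuousOn_toLeft : ContinuousOn (toLeft f f') {x | level f f' x < 1} := by
  rw [(isQuotientMap_mk f f').continuousOn_isOpen_iff
    (isOpen_lt (continuous_level f f') continuous_const)]
  rintro (a | a | ⟨a, t⟩) hx
  · refine ContinuousAt.continuousWithinAt ?_
    rw [IsOpenEmbedding.inl.continuousAt_iff.symm]
    exact continuousAt_id
  · norm_num [level, mk] at hx
  · refine ContinuousAt.continuousWithinAt ?_
    rw [IsOpenEmbedding.inr.continuousAt_iff.symm, IsOpenEmbedding.inr.continuousAt_iff.symm]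
    refine (f.continuous_toFun.comp continuous_fst).continuousAt.congr ?_
    have ho : IsOpen {p : H.space × CylInterval | (p.2 : ℝ) < 1} :=
      isOpen_lt (continuous_subtype_val.comp continuous_snd) continuous_const
    filter_upwards [ho.mem_nhds hx] with p hp
    exact (toLeft_mk f f' hp).symm

theorem continuousOn_toRight : ContinuousOn (toRight f f') {x | -1 < level f f' x} := by
  rw [(isQuotientMap_mk f f').continuousOn_isOpen_iff
    (isOpen_lt continuous_const (continuous_level f f'))]
  rintro (a | a | ⟨a, t⟩) hx
  · norm_num [level, mk] at hx
  · refine ContinuousAt.continuousWithinAt ?_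
    rw [IsOpenEmbedding.inr.continuousAt_iff.symm, IsOpenEmbedding.inl.continuousAt_iff.symm]
    exact continuousAt_id
  · refine ContinuousAt.continuousWithinAt ?_
    rw [IsOpenEmbedding.inr.continuousAt_iff.symm, IsOpenEmbedding.inr.continuousAt_iff.symm]
    refine (f'.continuous_toFun.comp continuous_fst).continuousAt.congr ?_
    have ho : IsOpen {p : H.space × CylInterval | -1 < (p.2 : ℝ)} :=
      isOpen_lt continuous_const (continuous_subtype_val.comp continuous_snd)
    filter_upwards [ho.mem_nhds hx] with p hp
    exact (toRight_mk f f' hp).symm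

theorem eq_left {x : DoubleMappingCylinder f f'} (hx : level f f' x = -1) :
    x = mk f f' (.inl (toLeft f f' x)) := by
  induction x using ind with
  | left a => rfl
  | right a => norm_num [level, mk] at hx
  | mid a t =>
    obtain rfl : t = cylLeft := Subtype.ext hx
    rw [mk_left]
    rfl

theorem eq_right {x : DoubleMappingCylinder f f'} (hx : level f f' x = 1) :
    x = mk f f' (.inr (.inl (toRight f f' x))) := by
  induction x using ind with
  | left a => norm_num [level, mk] at hx
  | right a => rfl
  | mid a t =>
    obtain rfl : t = cylRight := Subtype.ext hx
    rw [mk_right]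
    rfl

theorem level_mem (x : DoubleMappingCylinder f f') : level f f' x ∈ Icc (-1 : ℝ) 1 := by
  induction x using ind with
  | left a => exact cylLeft.2
  | right a => exact cylRight.2
  | mid a t => exact t.2

/-! ### Lines and flows in the interval direction -/

/-- The line `G/H ∋ a ↦ {a} × [-1, 1]`, extended to `ℝ` by constants. -/
def midLine (a : H.space) : C(ℝ, DoubleMappingCylinder f f') where
  toFun r := mk f f' (.inr (.inr (a, projIcc (-1) 1 (by norm_num) r)))
  continuous_toFun := (isQuotientMap_mk f f').continuous.comp (continuous_inr.comp
    (continuous_inr.comp (continuous_const.prodMk (continuous_projIcc (h := by norm_num)))))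

theorem smul_midLine (g : G) (a : H.space) (r : ℝ) :
    g • midLine f f' a r = midLine f f' (g • a) r := rfl

theorem level_midLine (a : H.space) {r : ℝ} (hr : r ∈ Icc (-1 : ℝ) 1) :
    level f f' (midLine f f' a r) = r :=
  congrArg Subtype.val (projIcc_of_mem (by norm_num) hr)

/-- The linear deformation to a self-map `ψ` of the interval fixing the end points. -/
def flow (ψ : C(ℝ, ℝ)) (h₀ : ψ (-1) = -1) (h₁ : ψ 1 = 1) :
    C(DoubleMappingCylinder f f' × ℝ, DoubleMappingCylinder f f') where
  toFun p := Quot.lift (fun x => match x with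
    | .inl a => mk f f' (.inl a)
    | .inr (.inl a) => mk f f' (.inr (.inl a))
    | .inr (.inr (a, t)) => midLine f f' a (AffineMap.lineMap (t : ℝ) (ψ t) p.2)) (by
      rintro _ _ (a | a)
      · have h : AffineMap.lineMap (cylLeft : ℝ) (ψ cylLeft) p.2 = (-1 : ℝ) := by
          change AffineMap.lineMap (-1 : ℝ) (ψ (-1)) p.2 = -1
          rw [h₀, AffineMap.lineMap_same_apply]
        refine Eq.trans ?_ (mk_left f f' a)
        change midLine f f' a (AffineMap.lineMap (cylLeft : ℝ) (ψ cylLeft) p.2) = _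
        rw [h]
        exact congrArg (fun t => mk f f' (.inr (.inr (a, t)))) (projIcc_left _)
      · have h : AffineMap.lineMap (cylRight : ℝ) (ψ cylRight) p.2 = (1 : ℝ) := by
          change AffineMap.lineMap (1 : ℝ) (ψ 1) p.2 = 1
          rw [h₁, AffineMap.lineMap_same_apply]
        refine Eq.trans ?_ (mk_right f f' a)
        change midLine f f' a (AffineMap.lineMap (cylRight : ℝ) (ψ cylRight) p.2) = _
        rw [h]
        exact congrArg (fun t => mk f f' (.inr (.inr (a, t)))) (projIcc_right _)) p.1
  continuous_toFun := by
    -- The product of the quotient map with the locally compact space `ℝ` is again a quotient map.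
    refine (isQuotientMap_mk f f').continuous_lift_prod_left ?_
    let φ : PreCylinder H K L × ℝ ≃ₜ (K.space × ℝ) ⊕ (L.space × ℝ) ⊕ ((H.space × CylInterval) × ℝ) :=
      Homeomorph.sumProdDistrib.trans ((Homeomorph.refl _).sumCongr Homeomorph.sumProdDistrib)
    rw [← φ.symm.comp_continuous_iff']
    have hq := (isQuotientMap_mk f f').continuous
    refine continuous_sum_dom.mpr ⟨?_, continuous_sum_dom.mpr ⟨?_, ?_⟩⟩
    · exact hq.comp (continuous_inl.comp continuous_fst)
    · exact hq.comp (continuous_inr.comp (continuous_inl.comp continuous_fst))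
    · refine hq.comp (continuous_inr.comp (continuous_inr.comp
        ((continuous_fst.comp continuous_fst).prodMk ((continuous_projIcc (h := by norm_num)).comp ?_))))
      simp only [AffineMap.lineMap_apply_ring]
      fun_prop

section flow

variable (ψ : C(ℝ, ℝ)) (h₀ : ψ (-1) = -1) (h₁ : ψ 1 = 1)

theorem flow_zero (x : DoubleMappingCylinder f f') : flow f f' ψ h₀ h₁ (x, 0) = x := by
  induction x using ind with
  | left a => rfl
  | right a => rfl
  | mid a t =>
    change midLine f f' a (AffineMap.lineMap (t : ℝ) (ψ t) (0 : ℝ)) = _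
    rw [AffineMap.lineMap_apply_zero, midLine]
    change mk f f' _ = _
    rw [projIcc_val]

theorem flow_smul (g : G) (x : DoubleMappingCylinder f f') (r : ℝ) :
    flow f f' ψ h₀ h₁ (g • x, r) = g • flow f f' ψ h₀ h₁ (x, r) := by
  induction x using ind <;> rfl

theorem flow_of_abs_lt {x : DoubleMappingCylinder f f'} (hx : |level f f' x| < 1) (r : ℝ) :
    flow f f' ψ h₀ h₁ (x, r) =
      midLine f f' (toMid f f' x) (AffineMap.lineMap (level f f' x) (ψ (level f f' x)) r) := by
  induction x using ind with
  | left a => norm_num [level, mk] at hx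
  | right a => norm_num [level, mk] at hx
  | mid a t =>
    rw [toMid_mk f f' hx]
    rfl

theorem flow_of_level_eq {x : DoubleMappingCylinder f f'}
    (hx : level f f' x = -1 ∨ level f f' x = 1) (r : ℝ) : flow f f' ψ h₀ h₁ (x, r) = x := by
  rcases hx with hx | hx
  · rw [eq_left f f' hx]
    rfl
  · rw [eq_right f f' hx]
    rfl

end flow

end DoubleMappingCylinder

/-! ### Natural transformations out of the cellular chains -/

namespace GCWStructure

variable {G : Type u} [Group G] [TopologicalSpace G] {X : Type u} [MulAction G X]
  [TopologicalSpace X] [ContinuousSMul G X] (S : GCWStructure G X)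

/-- The class of a relative cycle in the cellular chains. -/
def cellClass {n : ℕ} {Γ : (Orb G)ᵒᵖ} (c : relCycles ((fixedPointSystem G X).obj Γ)
    (S.fixedSkeletonLT (n + 1) Γ) (S.fixedSkeletonLT n Γ) n) : (S.cellularChains n).obj Γ :=
  Submodule.Quotient.mk c

theorem map_cellClass {n : ℕ} {Γ Γ' : (Orb G)ᵒᵖ} (f : Γ ⟶ Γ')
    (c : relCycles ((fixedPointSystem G X).obj Γ)
      (S.fixedSkeletonLT (n + 1) Γ) (S.fixedSkeletonLT n Γ) n) :
    (S.cellularChains n).map f (S.cellClass c) =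
      S.cellClass ⟨singMap ((fixedPointSystem G X).map f) n c,
        singMap_mem_relCycles _ (S.mapsTo_fixedSkeletonLT (n + 1) f)
          (S.mapsTo_fixedSkeletonLT n f) n c c.2⟩ := rfl

theorem cellularBoundary_cellClass {n : ℕ} {Γ : (Orb G)ᵒᵖ}
    (c : relCycles ((fixedPointSystem G X).obj Γ)
      (S.fixedSkeletonLT (n + 2) Γ) (S.fixedSkeletonLT (n + 1) Γ) (n + 1)) :
    (S.cellularBoundary n).app Γ (S.cellClass c) =
      S.cellClass ⟨singBoundary _ n c, singBoundary_mem_relCycles _ (S.fixedSkeletonLT (n + 2) Γ)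
        (S.fixedSkeletonLT (n + 1) Γ) (S.fixedSkeletonLT n Γ) n c c.2⟩ := rfl

variable {S} in
/-- A homomorphism out of cellular chains is determined by its values on representatives of a set
generating the relative cycles modulo relative boundaries. -/
theorem eq_of_generators {n : ℕ} {Γ : (Orb G)ᵒᵖ} {M : Type u} [AddCommGroup M]
    (φ ψ : (S.cellularChains n).obj Γ →+ M)
    (s : Set (SingChain ((fixedPointSystem G X).obj Γ) n))
    (hs : s ⊆ relCycles _ (S.fixedSkeletonLT (n + 1) Γ) (S.fixedSkeletonLT n Γ) n)
    (hgen : relCycles _ (S.fixedSkeletonLT (n + 1) Γ) (S.fixedSkeletonLT n Γ) n ≤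
      relBoundaries _ (S.fixedSkeletonLT (n + 1) Γ) (S.fixedSkeletonLT n Γ) n ⊔
        Submodule.span ℤ s)
    (h : ∀ c (hc : c ∈ s), φ (S.cellClass ⟨c, hs hc⟩) = ψ (S.cellClass ⟨c, hs hc⟩)) : φ = ψ := by
  ext x
  obtain ⟨⟨c, hc⟩, rfl⟩ : ∃ c, S.cellClass c = x := Submodule.Quotient.mk_surjective _ x
  obtain ⟨b, hb, e, he, rfl⟩ := Submodule.mem_sup.mp (hgen hc)
  -- Membership in the relative cycles is carried through the induction, since the class of `e`
  -- makes sense only with it.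
  have hspan : ∀ e ∈ Submodule.span ℤ s, ∃ he : e ∈ relCycles _ (S.fixedSkeletonLT (n + 1) Γ)
      (S.fixedSkeletonLT n Γ) n, φ (S.cellClass ⟨e, he⟩) = ψ (S.cellClass ⟨e, he⟩) := by
    intro e he
    induction he using Submodule.span_induction with
    | mem e he => exact ⟨hs he, h e he⟩
    | zero => exact ⟨zero_mem _, (map_zero φ).trans (map_zero ψ).symm⟩
    | add e e' _ _ h h' =>
      obtain ⟨h1, h2⟩ := h
      obtain ⟨h1', h2'⟩ := h'
      refine ⟨add_mem h1 h1', ?_⟩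
      change φ (S.cellClass ⟨e, h1⟩ + S.cellClass ⟨e', h1'⟩) =
        ψ (S.cellClass ⟨e, h1⟩ + S.cellClass ⟨e', h1'⟩)
      rw [map_add, map_add, h2, h2']
    | smul k e _ h =>
      obtain ⟨h1, h2⟩ := h
      refine ⟨Submodule.smul_mem _ k h1, ?_⟩
      change φ (k • S.cellClass ⟨e, h1⟩) = ψ (k • S.cellClass ⟨e, h1⟩)
      rw [map_zsmul, map_zsmul, h2]
  obtain ⟨he', h'⟩ := hspan e he
  have : S.cellClass ⟨b + e, hc⟩ = S.cellClass ⟨e, he'⟩ := by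
    refine (Submodule.Quotient.eq _).mpr ?_
    change b + e - e ∈ relBoundaries _ (S.fixedSkeletonLT (n + 1) Γ) (S.fixedSkeletonLT n Γ) n
    rwa [add_sub_cancel_right]
  rw [this, h']

/-- The natural transformation out of cellular chains defined by a natural system of singular
cochains vanishing on relative boundaries. -/
def natTransOfCochain (F : CoefficientSystem G) {n : ℕ}
    (ℓ : ∀ Γ, SingSimplex ((fixedPointSystem G X).obj Γ) n → F.toFunctor.obj Γ)
    (h0 : ∀ Γ, ∀ c ∈ relBoundaries _ (S.fixedSkeletonLT (n + 1) Γ) (S.fixedSkeletonLT n Γ) n,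
      Finsupp.linearCombination ℤ (ℓ Γ) c = 0)
    (hn : ∀ (Γ Γ' : (Orb G)ᵒᵖ) (f : Γ ⟶ Γ') σ,
      ℓ Γ' (SingSimplex.map ((fixedPointSystem G X).map f) σ) = F.toFunctor.map f (ℓ Γ σ)) :
    S.cellularChains n ⟶ F.toFunctor where
  app Γ := AddCommGrpCat.ofHom (Submodule.liftQ _
    ((Finsupp.linearCombination ℤ (ℓ Γ)).domRestrict _) fun c hc => h0 Γ c hc).toAddMonoidHom
  naturality Γ Γ' f := by
    ext x
    obtain ⟨⟨c, hc⟩, rfl⟩ : ∃ c, S.cellClass c = x := Submodule.Quotient.mk_surjective _ x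
    change Finsupp.linearCombination ℤ (ℓ Γ') (singMap ((fixedPointSystem G X).map f) n c) =
      F.toFunctor.map f (Finsupp.linearCombination ℤ (ℓ Γ) c)
    have : Finsupp.linearCombination ℤ (ℓ Γ') ∘ₗ singMap ((fixedPointSystem G X).map f) n =
        (F.toFunctor.map f).hom.toIntLinearMap ∘ₗ Finsupp.linearCombination ℤ (ℓ Γ) := by
      refine Finsupp.lhom_ext fun σ a => ?_
      simp only [LinearMap.comp_apply, singMap, Finsupp.lmapDomain_apply,
        Finsupp.mapDomain_single, Finsupp.linearCombination_single, hn]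
      exact (map_zsmul (F.toFunctor.map f).hom a _).symm
    exact congrArg (fun φ => φ c) this

end GCWStructure

/-! ### Skeleta and fixed points of the double mapping cylinder -/

namespace DoubleMappingCylinder

variable {G : Type u} [Group G] [TopologicalSpace G] [IsTopologicalGroup G] [LocallyCompactSpace G]
  {H K L : Orb G} (f : H ⟶ K) (f' : H ⟶ L)

/-- The index is shifted: `skeletonLT 1` is the 0-skeleton, that is, the two ends. -/
theorem mem_skeletonLT_one {x : DoubleMappingCylinder f f'} :
    x ∈ (gcwStructure f f').skeletonLT 1 ↔ level f f' x = -1 ∨ level f f' x = 1 := by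
  constructor
  · rintro ⟨m, hm, e, p, rfl⟩
    obtain rfl : m = 0 := by omega
    rcases e with ⟨_ | _⟩
    · exact .inl rfl
    · exact .inr rfl
  · rintro (h | h)
    · exact ⟨0, one_pos, ⟨false⟩, (toLeft f f' x, ⟨0, by simp⟩), (eq_left f f' h).symm⟩
    · exact ⟨0, one_pos, ⟨true⟩, (toRight f f' x, ⟨0, by simp⟩), (eq_right f f' h).symm⟩

theorem skeletonLT_zero : (gcwStructure f f').skeletonLT 0 = ∅ :=
  eq_empty_of_forall_notMem fun _ ⟨_, hm, _⟩ => Nat.not_lt_zero _ hm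

theorem skeletonLT_of_two_le {n : ℕ} (hn : 2 ≤ n) : (gcwStructure f f').skeletonLT n = univ := by
  refine eq_univ_of_forall fun x => ?_
  induction x using ind with
  | left a => exact ⟨0, by omega, ⟨false⟩, (a, ⟨0, by simp⟩), rfl⟩
  | right a => exact ⟨0, by omega, ⟨true⟩, (a, ⟨0, by simp⟩), rfl⟩
  | mid a t => exact ⟨1, by omega, PUnit.unit, (a, intervalToDisc t), rfl⟩

/-- The space of points of the cylinder fixed by the stabilizer `Γ`. -/
abbrev fixedSpace (Γ : (Orb G)ᵒᵖ) : TopCat.{u} :=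
  (fixedPointSystem G (DoubleMappingCylinder f f')).obj Γ

variable {f f'} in
theorem val_map_eq {Γ Γ' : (Orb G)ᵒᵖ} (φ : Γ ⟶ Γ') {g : G}
    (hg : φ.unop.toFun (Orb.base _) = QuotientGroup.mk g) (y : fixedSpace f f' Γ) :
    ((fixedPointSystem G (DoubleMappingCylinder f f')).map φ y).1 = g • y.1 := by
  change orbitEval y (φ.unop.toFun (Orb.base _)) = _
  rw [hg]
  rfl

theorem continuous_val (Γ : (Orb G)ᵒᵖ) :
    Continuous fun y : fixedSpace f f' Γ => (y.1 : DoubleMappingCylinder f f') :=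
  continuous_subtype_val

theorem toMid_mem {Γ : (Orb G)ᵒᵖ} {y : fixedSpace f f' Γ} (hy : |level f f' y.1| < 1) :
    toMid f f' y.1 ∈ MulAction.fixedPoints Γ.unop.stab H.space :=
  MulAction.mem_fixedPoints_of_smul (fun g => toMid_smul f f' g hy) y.2

theorem toLeft_mem {Γ : (Orb G)ᵒᵖ} {y : fixedSpace f f' Γ} (hy : level f f' y.1 < 1) :
    toLeft f f' y.1 ∈ MulAction.fixedPoints Γ.unop.stab K.space :=
  MulAction.mem_fixedPoints_of_smul (fun g => toLeft_smul f f' g hy) y.2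

theorem toRight_mem {Γ : (Orb G)ᵒᵖ} {y : fixedSpace f f' Γ} (hy : -1 < level f f' y.1) :
    toRight f f' y.1 ∈ MulAction.fixedPoints Γ.unop.stab L.space :=
  MulAction.mem_fixedPoints_of_smul (fun g => toRight_smul f f' g hy) y.2

/-- The line through a fixed point of `G/H`. -/
def fixedLine {Γ : (Orb G)ᵒᵖ} (a : MulAction.fixedPoints Γ.unop.stab H.space) :
    C(ℝ, fixedSpace f f' Γ) where
  toFun r := ⟨midLine f f' a.1 r, fun g => by
    change (g : G) • midLine f f' a.1 r = _
    rw [smul_midLine]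
    exact congrArg (midLine f f' · r) (a.2 g)⟩
  continuous_toFun := (midLine f f' a.1).continuous.subtype_mk _

/-- A fixed point of `G/K`, in the left end of the cylinder. -/
def fixedLeft {Γ : (Orb G)ᵒᵖ} (a : MulAction.fixedPoints Γ.unop.stab K.space) :
    fixedSpace f f' Γ :=
  ⟨mk f f' (.inl a.1), fun g => congrArg (fun x => mk f f' (.inl x)) (a.2 g)⟩

/-- A fixed point of `G/L`, in the right end of the cylinder. -/
def fixedRight {Γ : (Orb G)ᵒᵖ} (a : MulAction.fixedPoints Γ.unop.stab L.space) :
    fixedSpace f f' Γ :=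
  ⟨mk f f' (.inr (.inl a.1)), fun g => congrArg (fun x => mk f f' (.inr (.inl x))) (a.2 g)⟩

/-- The deformation of the fixed points induced by a self-map of the interval. -/
def fixedFlow (Γ : (Orb G)ᵒᵖ) (ψ : C(ℝ, ℝ)) (h₀ : ψ (-1) = -1) (h₁ : ψ 1 = 1) :
    C(fixedSpace f f' Γ × ℝ, fixedSpace f f' Γ) where
  toFun p := ⟨flow f f' ψ h₀ h₁ (p.1.1, p.2), fun g => by
    change (g : G) • flow f f' ψ h₀ h₁ (p.1.1, p.2) = _
    rw [← flow_smul]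
    exact congrArg (fun x => flow f f' ψ h₀ h₁ (x, p.2)) (p.1.2 g)⟩
  continuous_toFun := by
    refine Continuous.subtype_mk ((flow f f' ψ h₀ h₁).continuous.comp ?_) _
    exact ((continuous_val f f' Γ).comp continuous_fst).prodMk continuous_snd

/-- The piecewise linear self-map of `[-1, 1]` used to deform the points of level `< 1/2`
(for `c = -3`) or `> -1/2` (for `c = 3`) to the ends. -/
def clampMap (c : ℝ) : C(ℝ, ℝ) where
  -- `4t - 3` runs from `-1` at `t = 1/2` to `1` at `t = 1`, and `4t + 3` from `-1` at `t = -1` to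
  -- `1` at `t = -1/2`. Both clamped maps fix `±1`.
  toFun t := max (-1) (min 1 (4 * t + c))

theorem midLine_mem_skeletonLT_one {a : H.space} {r : ℝ} (hr : r = -1 ∨ r = 1) :
    midLine f f' a r ∈ (gcwStructure f f').skeletonLT 1 := by
  rw [mem_skeletonLT_one, level_midLine f f' a (by rcases hr with rfl | rfl <;> norm_num)]
  exact hr

theorem fixedFlow_of_mem {Γ : (Orb G)ᵒᵖ} {ψ : C(ℝ, ℝ)} {h₀ : ψ (-1) = -1} {h₁ : ψ 1 = 1}
    {y : fixedSpace f f' Γ} (hy : y ∈ (gcwStructure f f').fixedSkeletonLT 1 Γ) (r : ℝ) :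
    fixedFlow f f' Γ ψ h₀ h₁ (y, r) = y :=
  Subtype.ext (flow_of_level_eq f f' ψ h₀ h₁ ((mem_skeletonLT_one f f').mp hy) r)

theorem fixedFlow_one_mem {Γ : (Orb G)ᵒᵖ} {ψ : C(ℝ, ℝ)} {h₀ : ψ (-1) = -1} {h₁ : ψ 1 = 1}
    {y : fixedSpace f f' Γ} (hy : ψ (level f f' y.1) = -1 ∨ ψ (level f f' y.1) = 1) :
    fixedFlow f f' Γ ψ h₀ h₁ (y, 1) ∈ (gcwStructure f f').fixedSkeletonLT 1 Γ := by
  by_cases h : |level f f' y.1| < 1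
  · change flow f f' ψ h₀ h₁ (y.1, 1) ∈ (gcwStructure f f').skeletonLT 1
    rw [flow_of_abs_lt f f' ψ h₀ h₁ h, AffineMap.lineMap_apply_one]
    exact midLine_mem_skeletonLT_one f f' hy
  · have hm : y ∈ (gcwStructure f f').fixedSkeletonLT 1 Γ := by
      refine (mem_skeletonLT_one f f').mpr ?_
      have h' := le_antisymm (abs_le.mpr (level_mem f f' y.1)) (not_lt.mp h)
      exact ((abs_eq zero_le_one).mp h').symm
    rwa [fixedFlow_of_mem f f' hm]

/-- The flows on the fixed points of the double mapping cylinder. -/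
def twoFlows (Γ : (Orb G)ᵒᵖ) : TwoFlows (fixedSpace f f' Γ)
    ((gcwStructure f f').fixedSkeletonLT 1 Γ) (MulAction.fixedPoints Γ.unop.stab H.space) where
  level := ⟨fun y => level f f' y.1, (continuous_level f f').comp (continuous_val f f' Γ)⟩
  down := fixedFlow f f' Γ (clampMap (-3)) (by norm_num [clampMap]) (by norm_num [clampMap])
  up := fixedFlow f f' Γ (clampMap 3) (by norm_num [clampMap]) (by norm_num [clampMap])
  line := fixedLine f f'
  down_zero y := Subtype.ext (flow_zero f f' _ _ _ y.1)
  up_zero y := Subtype.ext (flow_zero f f' _ _ _ y.1)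
  down_mem y hy r := by rwa [fixedFlow_of_mem f f' hy]
  up_mem y hy r := by rwa [fixedFlow_of_mem f f' hy]
  down_one y hy := by
    refine fixedFlow_one_mem f f' (.inl ?_)
    change level f f' y.1 < 1 / 2 at hy
    exact max_eq_left ((min_le_right _ _).trans (by linarith))
  up_one y hy := by
    refine fixedFlow_one_mem f f' (.inr ?_)
    change -(1 / 2) < level f f' y.1 at hy
    change max _ (min _ _) = _
    rw [min_eq_left (by linarith)]
    norm_num
  exists_line y hy := by
    change |level f f' y.1| < 1 / 2 at hy
    have h : |level f f' y.1| < 1 := by linarith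
    have h' := abs_lt.mp hy
    -- The line is the one through the `G/H`-coordinate of `y`, and the starting parameter is the
    -- level of `y`.
    refine ⟨⟨toMid f f' y.1, toMid_mem f f' h⟩, level f f' y.1, fun r =>
      ⟨Subtype.ext ?_, Subtype.ext ?_⟩⟩
    · refine (flow_of_abs_lt f f' _ _ _ h r).trans ?_
      have : clampMap (-3) (level f f' y.1) = -1 :=
        max_eq_left ((min_le_right _ _).trans (by linarith))
      rw [this]
      rfl
    · refine (flow_of_abs_lt f f' _ _ _ h r).trans ?_
      have : clampMap 3 (level f f' y.1) = 1 := by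
        change max _ (min _ _) = _
        rw [min_eq_left (by linarith)]
        norm_num
      rw [this]
      rfl

end DoubleMappingCylinder

namespace DoubleMappingCylinder

open SingSimplex

variable {G : Type u} [Group G] [TopologicalSpace G] [IsTopologicalGroup G] [LocallyCompactSpace G]
  {H K L : Orb G} (f : H ⟶ K) (f' : H ⟶ L)

/-! ### Cochains in degree `1` -/

theorem point_mem_chainsIn {X : TopCat.{u}} {A : Set X} {x : X} (hx : x ∈ A) :
    point x ∈ chainsIn X A 0 :=
  Finsupp.single_mem_supported ℤ 1 fun t => by
    rw [toMap_ofMap]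
    exact hx

theorem singMap_point {X Y : TopCat.{u}} (g : X ⟶ Y) (x : X) :
    singMap g 0 (point x) = point (g x) := by
  rw [singMap, point, Finsupp.lmapDomain_apply, Finsupp.mapDomain_single]
  rfl

theorem edge_mem_relCycles {Γ : (Orb G)ᵒᵖ} (a : MulAction.fixedPoints Γ.unop.stab H.space) :
    edge (fixedLine f f' a) (-1) 1 ∈ relCycles (fixedSpace f f' Γ)
      ((gcwStructure f f').fixedSkeletonLT 2 Γ) ((gcwStructure f f').fixedSkeletonLT 1 Γ) 1 := by
  refine ⟨TwoFlows.edge_mem_chainsIn _ _ _ fun r => ?_, ?_⟩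
  · change _ ∈ (gcwStructure f f').skeletonLT 2
    rw [skeletonLT_of_two_le f f' le_rfl]
    trivial
  · change singBoundary _ 0 (edge (fixedLine f f' a) (-1) 1) ∈
      chainsIn _ ((gcwStructure f f').fixedSkeletonLT 1 Γ) 0
    rw [singBoundary_edge]
    exact sub_mem (point_mem_chainsIn (midLine_mem_skeletonLT_one f f' (.inr rfl)))
      (point_mem_chainsIn (midLine_mem_skeletonLT_one f f' (.inl rfl)))

/-- The cellular `1`-chain given by a fixed point of `G/H`. -/
def lineClass {Γ : (Orb G)ᵒᵖ} (a : MulAction.fixedPoints Γ.unop.stab H.space) :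
    ((gcwStructure f f').cellularChains 1).obj Γ :=
  (gcwStructure f f').cellClass ⟨_, edge_mem_relCycles f f' a⟩

/-- The basepoint of `G/K`, as a point fixed by `K`. -/
def fixedBase (K : Orb G) : MulAction.fixedPoints K.stab K.space := ⟨K.base, K.base_mem_fixedPoints⟩

theorem map_fixedLine {Γ : Orb G} (a : MulAction.fixedPoints Γ.stab H.space) (r : ℝ) :
    (fixedPointSystem G (DoubleMappingCylinder f f')).map (Orb.ofFixed a).op
      (fixedLine f f' (Γ := op H) (fixedBase H) r) = fixedLine f f' (Γ := op Γ) a r := by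
  obtain ⟨g, hg⟩ := QuotientGroup.mk_surjective a.1
  refine Subtype.ext ((val_map_eq (Orb.ofFixed a).op (g := g) ?_ _).trans ?_)
  · exact (Orb.ofFixed_base a).trans hg.symm
  · change g • midLine f f' H.base r = midLine f f' a.1 r
    rw [smul_midLine, ← hg]
    exact congrArg (midLine f f' · r) (congrArg QuotientGroup.mk (mul_one g))

/-- The Yoneda step: all line classes come from the one over the basepoint of `G/H`, so a natural
transformation takes values on them determined by a single element of `F(G/H)`. -/
theorem map_lineClass {Γ : Orb G} (a : MulAction.fixedPoints Γ.stab H.space) :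
    ((gcwStructure f f').cellularChains 1).map (Orb.ofFixed a).op
      (lineClass f f' (Γ := op H) (fixedBase H)) = lineClass f f' (Γ := op Γ) a := by
  rw [lineClass, GCWStructure.map_cellClass]
  refine congrArg (GCWStructure.cellClass _) (Subtype.ext ?_)
  change singMap _ 1 (edge (fixedLine f f' (Γ := op H) (fixedBase H)) (-1) 1) =
    edge (fixedLine f f' (Γ := op Γ) a) (-1) 1
  rw [edge, singMap, Finsupp.lmapDomain_apply, Finsupp.mapDomain_single, map_affine]
  exact edge_congr fun r => map_fixedLine f f' a _

variable (F : CoefficientSystem G)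

variable {F} in
theorem app_map {n : ℕ} (φ : (gcwStructure f f').cellularChains n ⟶ F.toFunctor) {J J' : Orb G}
    (h : J ⟶ J') (x : ((gcwStructure f f').cellularChains n).obj (op J')) :
    φ.app (op J) (((gcwStructure f f').cellularChains n).map h.op x) =
      F.pull h (φ.app (op J') x) :=
  congrArg (fun ψ => ψ.hom x) (φ.naturality h.op)

/-- Evaluation of `1`-cochains on the `1`-cell. -/
def evalOne : ((gcwStructure f f').cellularChains 1 ⟶ F.toFunctor) →+ F.val H where
  toFun φ := φ.app (op H) (lineClass f f' (Γ := op H) (fixedBase H))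
  map_zero' := rfl
  map_add' _ _ := rfl

theorem evalOne_injective : Function.Injective (evalOne f f' F) := by
  intro φ ψ h
  refine NatTrans.ext (funext fun Γ => AddCommGrpCat.hom_ext ?_)
  refine GCWStructure.eq_of_generators (S := gcwStructure f f') (n := 1)
    (φ.app Γ).hom (ψ.app Γ).hom
    (range fun a => edge (fixedLine f f' (Γ := Γ) a) (-1) 1) ?_ ?_ ?_
  · rintro _ ⟨a, rfl⟩
    exact edge_mem_relCycles f f' a
  · have h2 : (gcwStructure f f').fixedSkeletonLT 2 Γ = univ :=
      eq_univ_of_forall fun y => by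
        change _ ∈ (gcwStructure f f').skeletonLT 2
        rw [skeletonLT_of_two_le f f' le_rfl]
        trivial
    change relCycles (fixedSpace f f' Γ) ((gcwStructure f f').fixedSkeletonLT 2 Γ) _ 1 ≤
      relBoundaries (fixedSpace f f' Γ) ((gcwStructure f f').fixedSkeletonLT 2 Γ) _ 1 ⊔ _
    rw [h2]
    exact (twoFlows f f' Γ).relCycles_le
  · rintro _ ⟨a, rfl⟩
    induction Γ using Opposite.rec with
    | op Γ =>
      change φ.app (op Γ) (lineClass f f' (Γ := op Γ) a) = ψ.app (op Γ) (lineClass f f' a)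
      rw [← map_lineClass, app_map, app_map]
      exact congrArg _ h

/-- The level of a fixed point. -/
def fixedLevel (Γ : (Orb G)ᵒᵖ) (y : fixedSpace f f' Γ) : ℝ := level f f' y.1

theorem continuous_fixedLevel (Γ : (Orb G)ᵒᵖ) : Continuous (fixedLevel f f' Γ) :=
  (continuous_level f f').comp (continuous_val f f' Γ)

variable {F} in
open Classical in
/-- The function on the interior of the cylinder, with values in a coefficient system, defined by
an element of `F(G/H)`. -/
def midValue (a : F.val H) (Γ : (Orb G)ᵒᵖ) (y : fixedSpace f f' Γ) : F.toFunctor.obj Γ :=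
  if |fixedLevel f f' Γ y| < 1 then F.evalAt a Γ.unop (toMid f f' y.1) else 0

/-- In the interior `toMid` is continuous and equivariant, so it carries the path to a path in
`(G/H)^Γ`, along which `evalAt` is constant. -/
theorem midValue_eq_of_joinedIn (a : F.val H) (Γ : (Orb G)ᵒᵖ) {y y' : fixedSpace f f' Γ}
    (h : JoinedIn {y | |fixedLevel f f' Γ y| < 1} y y') :
    midValue f f' a Γ y = midValue f f' a Γ y' := by
  have h1 : |fixedLevel f f' Γ y| < 1 := h.source_mem
  have h2 : |fixedLevel f f' Γ y'| < 1 := h.target_mem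
  rw [midValue, midValue, if_pos h1, if_pos h2]
  refine F.evalAt_eq_of_joinedIn a (JoinedIn.mono (h.map_continuousOn (f := fun y => toMid f f' y.1)
    ((continuousOn_toMid f f').comp (continuous_val f f' Γ).continuousOn fun _ h => h)) ?_)
  rintro _ ⟨y, hy, rfl⟩
  exact toMid_mem f f' hy

theorem fixedLevel_map {Γ Γ' : (Orb G)ᵒᵖ} (φ : Γ ⟶ Γ') (y : fixedSpace f f' Γ) :
    fixedLevel f f' Γ' ((fixedPointSystem G (DoubleMappingCylinder f f')).map φ y) =
      fixedLevel f f' Γ y := by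
  obtain ⟨g, hg⟩ := Orb.exists_rep φ.unop
  rw [fixedLevel, val_map_eq φ hg, level_smul, fixedLevel]

theorem midValue_map (a : F.val H) {Γ Γ' : (Orb G)ᵒᵖ} (φ : Γ ⟶ Γ') (y : fixedSpace f f' Γ) :
    midValue f f' a Γ' ((fixedPointSystem G (DoubleMappingCylinder f f')).map φ y) =
      F.toFunctor.map φ (midValue f f' a Γ y) := by
  rw [midValue, midValue, fixedLevel_map]
  split_ifs with h
  · obtain ⟨g, hg⟩ := Orb.exists_rep φ.unop
    rw [val_map_eq φ hg, toMid_smul f f' g h]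
    exact (F.pull_evalAt φ.unop a hg (toMid_mem f f' h)).symm
  · exact (map_zero (F.toFunctor.map φ).hom).symm

variable {F} in
/-- The singular `1`-cochain of jumps across the middle of the cylinder. -/
def jumpCochain (a : F.val H) (Γ : (Orb G)ᵒᵖ) (σ : SingSimplex (fixedSpace f f' Γ) 1) :
    F.toFunctor.obj Γ :=
  jump (fixedLevel f f' Γ) (midValue f f' a Γ) σ

/-- The induced map preserves levels and changes `midValue` by `F(φ)`, so `F(φ)` applied to a
primitive for `σ` is a primitive for its image. -/
theorem jumpCochain_map (a : F.val H) {Γ Γ' : (Orb G)ᵒᵖ} (φ : Γ ⟶ Γ')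
    (σ : SingSimplex (fixedSpace f f' Γ) 1) :
    jumpCochain f f' a Γ' (SingSimplex.map
      ((fixedPointSystem G (DoubleMappingCylinder f f')).map φ) σ) =
      F.toFunctor.map φ (jumpCochain f f' a Γ σ) := by
  obtain ⟨s, hs⟩ := exists_isJumpPrimitive (continuous_fixedLevel f f' Γ)
    (fun _ _ => midValue_eq_of_joinedIn f f' F a Γ) σ
  have hs' := hs.map (F.toFunctor.map φ).hom
  have e1 : fixedLevel f f' Γ' ∘ (SingSimplex.map
      ((fixedPointSystem G (DoubleMappingCylinder f f')).map φ) σ).toMap =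
      fixedLevel f f' Γ ∘ σ.toMap :=
    funext fun t => fixedLevel_map f f' φ (σ.toMap t)
  have e2 : midValue f f' a Γ' ∘ (SingSimplex.map
      ((fixedPointSystem G (DoubleMappingCylinder f f')).map φ) σ).toMap =
      (F.toFunctor.map φ).hom ∘ midValue f f' a Γ ∘ σ.toMap :=
    funext fun t => midValue_map f f' F a φ (σ.toMap t)
  rw [← e1, ← e2] at hs'
  rw [jumpCochain, jumpCochain, jump_eq hs', jump_eq hs]
  exact (map_sub (F.toFunctor.map φ).hom _ _).symm

/-- The cochain is closed, and it vanishes on chains in the 0-skeleton because the level is `±1`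
there. -/
theorem jumpCochain_relBoundaries (a : F.val H) (Γ : (Orb G)ᵒᵖ)
    (c : SingChain (fixedSpace f f' Γ) 1)
    (hc : c ∈ relBoundaries _ ((gcwStructure f f').fixedSkeletonLT 2 Γ)
      ((gcwStructure f f').fixedSkeletonLT 1 Γ) 1) :
    Finsupp.linearCombination ℤ (jumpCochain f f' a Γ) c = 0 := by
  have hτ := continuous_fixedLevel f f' Γ
  obtain ⟨_, ⟨e, -, rfl⟩, b, hb, rfl⟩ := Submodule.mem_sup.mp hc
  change jumpChain (fixedLevel f f' Γ) (midValue f f' a Γ) (_ + b) = 0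
  rw [map_add, jumpChain_boundary hτ (fun _ _ => midValue_eq_of_joinedIn f f' F a Γ),
    jumpChain_eq_zero hτ (fun _ _ => midValue_eq_of_joinedIn f f' F a Γ) (fun y hy => ?_) hb,
    add_zero]
  rcases (mem_skeletonLT_one f f').mp hy with h | h
  · exact h.trans_ne (by norm_num)
  · exact h.trans_ne one_ne_zero

/-- On the line over the basepoint, `w` is constantly `a` in the strip. The step function from `0`
to `a` is then a primitive, with increment `a`. -/
theorem jumpCochain_line (a : F.val H) :
    jumpCochain f f' a (op H) (affine (fixedLine f f' (Γ := op H) (fixedBase H)) ![-1, 1]) = a := by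
  have h := IsJumpPrimitive.of_const
    (τ := fixedLevel f f' (op H) ∘
      (affine (fixedLine f f' (Γ := op H) (fixedBase H)) ![-1, 1]).toMap)
    (w := midValue f f' a (op H) ∘
      (affine (fixedLine f f' (Γ := op H) (fixedBase H)) ![-1, 1]).toMap)
    ((continuous_fixedLevel f f' (op H)).comp (ContinuousMap.continuous _)) a (fun z hz => by
      rw [Function.comp_apply] at hz ⊢
      rw [midValue, if_pos hz]
      rw [toMap_affine_edge] at hz ⊢
      have : toMid f f' (midLine f f' H.base (AffineMap.lineMap (-1 : ℝ) (1 : ℝ) (z.1 1))) =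
        H.base := toMid_mk f f' hz
      refine (congrArg _ this).trans (F.evalAt_base a))
  rw [jumpCochain, jump_eq h]
  have e1 : level f f' (midLine f f' H.base (AffineMap.lineMap (-1 : ℝ) (1 : ℝ) (1 : ℝ))) = 1 := by
    rw [AffineMap.lineMap_apply_one, level_midLine f f' _ (by norm_num)]
  have e0 : level f f' (midLine f f' H.base (AffineMap.lineMap (-1 : ℝ) (1 : ℝ) (0 : ℝ))) = -1 := by
    rw [AffineMap.lineMap_apply_zero, level_midLine f f' _ (by norm_num)]
  simp only [Function.comp_apply, toMap_affine_edge]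
  rw [if_pos, if_neg, sub_zero]
  · refine not_lt.mpr (le_of_eq_of_le e0 (by norm_num))
  · exact lt_of_lt_of_eq one_pos e1.symm

theorem evalOne_surjective : Function.Surjective (evalOne f f' F) := fun a => by
  refine ⟨(gcwStructure f f').natTransOfCochain F (n := 1) (jumpCochain f f' a)
    (jumpCochain_relBoundaries f f' F a) (fun _ _ φ σ => jumpCochain_map f f' F a φ σ), ?_⟩
  change Finsupp.linearCombination ℤ (jumpCochain f f' a (op H))
    (edge (fixedLine f f' (Γ := op H) (fixedBase H)) (-1) 1) = a
  rw [edge, Finsupp.linearCombination_single, one_smul, jumpCochain_line]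

/-- `1`-cochains are elements of `F(G/H)`. -/
def evalOneEquiv : ((gcwStructure f f').cellularChains 1 ⟶ F.toFunctor) ≃+ F.val H :=
  AddEquiv.ofBijective (evalOne f f' F) ⟨evalOne_injective f f' F, evalOne_surjective f f' F⟩

end DoubleMappingCylinder

/-! ### Homology of short complexes of abelian groups with a zero map -/

theorem nonempty_homology_equiv_ker (S : ShortComplex AddCommGrpCat.{u}) (h : S.f = 0) :
    Nonempty (S.homology ≃+ S.g.hom.ker) :=
  ⟨(ShortComplex.LeftHomologyData.ofIsLimitKernelFork S h _
    (AddCommGrpCat.kernelIsLimit S.g)).homologyIso.addCommGroupIsoToAddEquiv⟩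

theorem nonempty_homology_equiv_quotient (S : ShortComplex AddCommGrpCat.{u}) (h : S.g = 0) :
    Nonempty (S.homology ≃+ S.X₂ ⧸ S.f.hom.range) :=
  ⟨(ShortComplex.LeftHomologyData.ofIsColimitCokernelCofork S h _
    (AddCommGrpCat.cokernelIsColimit S.f)).homologyIso.addCommGroupIsoToAddEquiv⟩

/-- The coboundary of the Bredon complex is precomposition with the cellular boundary. -/
theorem GCWStructure.bredonComplex_d {G : Type u} [Group G] [TopologicalSpace G] {X : Type u}
    [MulAction G X] [TopologicalSpace X] [ContinuousSMul G X] (S : GCWStructure G X)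
    (F : CoefficientSystem G) (n : ℕ) (φ : S.cellularChains n ⟶ F.toFunctor) :
    ((S.bredonComplex F).d n (n + 1)).hom φ = S.cellularBoundary n ≫ φ := by
  let d : ∀ n, AddCommGrpCat.of (S.cellularChains n ⟶ F.toFunctor) ⟶
      AddCommGrpCat.of (S.cellularChains (n + 1) ⟶ F.toFunctor) := fun n => AddCommGrpCat.ofHom
    { toFun := fun φ => S.cellularBoundary n ≫ φ
      map_zero' := Limits.comp_zero
      map_add' := fun φ ψ => Preadditive.comp_add _ _ _ _ φ ψ }
  have h : CochainComplex.of.d _ d n (n + 1) = d n := CochainComplex.of_d _ d n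
  exact congrArg (fun ψ => AddCommGrpCat.Hom.hom ψ φ) h

namespace DoubleMappingCylinder

open SingSimplex

variable {G : Type u} [Group G] [TopologicalSpace G] [IsTopologicalGroup G] [LocallyCompactSpace G]
  {H K L : Orb G} (f : H ⟶ K) (f' : H ⟶ L) (F : CoefficientSystem G)

/-! ### Cochains in degree `0` -/

/-- The cellular `0`-chain given by a point in the ends. -/
def pointClass {Γ : (Orb G)ᵒᵖ} {y : fixedSpace f f' Γ}
    (hy : y ∈ (gcwStructure f f').fixedSkeletonLT 1 Γ) :
    ((gcwStructure f f').cellularChains 0).obj Γ :=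
  (gcwStructure f f').cellClass ⟨point y, point_mem_chainsIn hy⟩

theorem fixedLeft_mem {Γ : (Orb G)ᵒᵖ} (a : MulAction.fixedPoints Γ.unop.stab K.space) :
    fixedLeft f f' a ∈ (gcwStructure f f').fixedSkeletonLT 1 Γ :=
  (mem_skeletonLT_one f f').mpr (.inl rfl)

theorem fixedRight_mem {Γ : (Orb G)ᵒᵖ} (a : MulAction.fixedPoints Γ.unop.stab L.space) :
    fixedRight f f' a ∈ (gcwStructure f f').fixedSkeletonLT 1 Γ :=
  (mem_skeletonLT_one f f').mpr (.inr rfl)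

theorem map_pointClass {Γ Γ' : (Orb G)ᵒᵖ} (φ : Γ ⟶ Γ') {y : fixedSpace f f' Γ}
    {y' : fixedSpace f f' Γ'} (hy : y ∈ (gcwStructure f f').fixedSkeletonLT 1 Γ)
    (hy' : y' ∈ (gcwStructure f f').fixedSkeletonLT 1 Γ')
    (h : (fixedPointSystem G (DoubleMappingCylinder f f')).map φ y = y') :
    ((gcwStructure f f').cellularChains 0).map φ (pointClass f f' hy) = pointClass f f' hy' := by
  rw [pointClass, GCWStructure.map_cellClass]
  refine congrArg (GCWStructure.cellClass _) (Subtype.ext ?_)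
  change singMap _ 0 (point y) = point y'
  rw [singMap_point, h]

theorem map_fixedLeft {Γ : Orb G} (a : MulAction.fixedPoints Γ.stab K.space) :
    (fixedPointSystem G (DoubleMappingCylinder f f')).map (Orb.ofFixed a).op
      (fixedLeft f f' (Γ := op K) (fixedBase K)) = fixedLeft f f' (Γ := op Γ) a := by
  obtain ⟨g, hg⟩ := QuotientGroup.mk_surjective a.1
  refine Subtype.ext ((val_map_eq (Orb.ofFixed a).op (g := g) ?_ _).trans ?_)
  · exact (Orb.ofFixed_base a).trans hg.symm
  · change mk f f' (.inl (g • K.base)) = mk f f' (.inl a.1)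
    rw [← hg]
    exact congrArg (fun x => mk f f' (.inl x)) (congrArg QuotientGroup.mk (mul_one g))

theorem map_fixedRight {Γ : Orb G} (a : MulAction.fixedPoints Γ.stab L.space) :
    (fixedPointSystem G (DoubleMappingCylinder f f')).map (Orb.ofFixed a).op
      (fixedRight f f' (Γ := op L) (fixedBase L)) = fixedRight f f' (Γ := op Γ) a := by
  obtain ⟨g, hg⟩ := QuotientGroup.mk_surjective a.1
  refine Subtype.ext ((val_map_eq (Orb.ofFixed a).op (g := g) ?_ _).trans ?_)
  · exact (Orb.ofFixed_base a).trans hg.symm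
  · change mk f f' (.inr (.inl (g • L.base))) = mk f f' (.inr (.inl a.1))
    rw [← hg]
    exact congrArg (fun x => mk f f' (.inr (.inl x))) (congrArg QuotientGroup.mk (mul_one g))

/-- Evaluation of `0`-cochains on the two `0`-cells. -/
def evalZero : ((gcwStructure f f').cellularChains 0 ⟶ F.toFunctor) →+ F.val K × F.val L where
  toFun φ := (φ.app (op K) (pointClass f f' (fixedLeft_mem f f' (Γ := op K) (fixedBase K))),
    φ.app (op L) (pointClass f f' (fixedRight_mem f f' (Γ := op L) (fixedBase L))))
  map_zero' := rfl
  map_add' _ _ := rfl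

variable {F} in
theorem app_fixedLeft (φ : (gcwStructure f f').cellularChains 0 ⟶ F.toFunctor) {Γ : Orb G}
    (a : MulAction.fixedPoints Γ.stab K.space) :
    φ.app (op Γ) (pointClass f f' (fixedLeft_mem f f' (Γ := op Γ) a)) =
      F.pull (Orb.ofFixed a) (evalZero f f' F φ).1 := by
  rw [← map_pointClass f f' (Orb.ofFixed a).op (fixedLeft_mem f f' (Γ := op K) (fixedBase K))
    (fixedLeft_mem f f' (Γ := op Γ) a) (map_fixedLeft f f' a), app_map]
  rfl

variable {F} in
theorem app_fixedRight (φ : (gcwStructure f f').cellularChains 0 ⟶ F.toFunctor) {Γ : Orb G}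
    (a : MulAction.fixedPoints Γ.stab L.space) :
    φ.app (op Γ) (pointClass f f' (fixedRight_mem f f' (Γ := op Γ) a)) =
      F.pull (Orb.ofFixed a) (evalZero f f' F φ).2 := by
  rw [← map_pointClass f f' (Orb.ofFixed a).op (fixedRight_mem f f' (Γ := op L) (fixedBase L))
    (fixedRight_mem f f' (Γ := op Γ) a) (map_fixedRight f f' a), app_map]
  rfl

theorem chainsIn_zero_le {X : TopCat.{u}} (A : Set X) :
    chainsIn X A 0 ≤ Submodule.span ℤ (point '' A) := by
  rw [chainsIn, Finsupp.supported_eq_span_single]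
  refine Submodule.span_mono ?_
  rintro _ ⟨σ, hσ, rfl⟩
  exact ⟨_, hσ (stdSimplex.vertex 0), point_toMap σ⟩

/-- Relative 0-cycles are combinations of points of the ends. Each such point is a fixed point of
`G/K` or `G/L`, hence the image of a basepoint under a `G`-map. -/
theorem evalZero_injective : Function.Injective (evalZero f f' F) := by
  intro φ ψ h
  refine NatTrans.ext (funext fun Γ => AddCommGrpCat.hom_ext ?_)
  refine GCWStructure.eq_of_generators (S := gcwStructure f f') (n := 0)
    (φ.app Γ).hom (ψ.app Γ).hom
    (point '' (gcwStructure f f').fixedSkeletonLT 1 Γ) ?_ ?_ ?_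
  · rintro _ ⟨y, hy, rfl⟩
    exact point_mem_chainsIn hy
  · exact (chainsIn_zero_le _).trans le_sup_right
  · rintro _ ⟨y, hy, rfl⟩
    induction Γ using Opposite.rec with
    | op Γ =>
      change φ.app (op Γ) (pointClass f f' hy) = ψ.app (op Γ) (pointClass f f' hy)
      rcases (mem_skeletonLT_one f f').mp hy with hl | hl
      · obtain ⟨a, rfl⟩ : ∃ a, y = fixedLeft f f' (Γ := op Γ) a :=
          ⟨⟨_, toLeft_mem f f' (hl.trans_lt (by norm_num))⟩, Subtype.ext (eq_left f f' hl)⟩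
        rw [app_fixedLeft, app_fixedLeft, h]
      · obtain ⟨a, rfl⟩ : ∃ a, y = fixedRight f f' (Γ := op Γ) a :=
          ⟨⟨_, toRight_mem f f' (lt_of_lt_of_eq (by norm_num) hl.symm)⟩,
            Subtype.ext (eq_right f f' hl)⟩
        rw [app_fixedRight, app_fixedRight, h]

variable {F} in
open Classical in
/-- The function on the ends of the cylinder defined by elements of `F(G/K)` and `F(G/L)`. -/
def endValue (a : F.val K × F.val L) (Γ : (Orb G)ᵒᵖ) (y : fixedSpace f f' Γ) :
    F.toFunctor.obj Γ :=
  if fixedLevel f f' Γ y = -1 then F.evalAt a.1 Γ.unop (toLeft f f' y.1)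
  else if fixedLevel f f' Γ y = 1 then F.evalAt a.2 Γ.unop (toRight f f' y.1) else 0

theorem endValue_map (a : F.val K × F.val L) {Γ Γ' : (Orb G)ᵒᵖ} (φ : Γ ⟶ Γ')
    (y : fixedSpace f f' Γ) :
    endValue f f' a Γ' ((fixedPointSystem G (DoubleMappingCylinder f f')).map φ y) =
      F.toFunctor.map φ (endValue f f' a Γ y) := by
  rw [endValue, endValue, fixedLevel_map]
  obtain ⟨g, hg⟩ := Orb.exists_rep φ.unop
  split_ifs with h h'
  · have h1 : level f f' y.1 < 1 := h.trans_lt (by norm_num)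
    rw [val_map_eq φ hg, toLeft_smul f f' g h1]
    exact (F.pull_evalAt φ.unop a.1 hg (toLeft_mem f f' h1)).symm
  · have h1 : -1 < level f f' y.1 := lt_of_lt_of_eq (by norm_num) h'.symm
    rw [val_map_eq φ hg, toRight_smul f f' g h1]
    exact (F.pull_evalAt φ.unop a.2 hg (toRight_mem f f' h1)).symm
  · exact (map_zero (F.toFunctor.map φ).hom).symm

/-- The level is constant on paths in the ends. -/
theorem joinedIn_level {Γ : (Orb G)ᵒᵖ} {y y' : fixedSpace f f' Γ}
    (h : JoinedIn ((gcwStructure f f').fixedSkeletonLT 1 Γ) y y') :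
    JoinedIn {z | fixedLevel f f' Γ z = -1} y y' ∨ JoinedIn {z | fixedLevel f f' Γ z = 1} y y' := by
  obtain ⟨γ, hγ⟩ := h
  have hl : ∀ t, fixedLevel f f' Γ (γ t) = -1 ∨ fixedLevel f f' Γ (γ t) = 1 := fun t =>
    (mem_skeletonLT_one f f').mp (hγ t)
  have hc : Continuous fun t => fixedLevel f f' Γ (γ t) :=
    (continuous_fixedLevel f f' Γ).comp γ.continuous
  by_cases hall : ∀ t, fixedLevel f f' Γ (γ t) = -1
  · exact .inl ⟨γ, hall⟩
  · obtain ⟨t, ht⟩ := not_forall.mp hall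
    refine .inr ⟨γ, fun t' => (hl t').resolve_left fun ht' => ?_⟩
    -- A path visiting both ends would pass through level `0`, which neither end contains.
    obtain ⟨r, hr⟩ := mem_range_of_exists_le_of_exists_ge hc
      ⟨t', ht'.le.trans (by norm_num : (-1 : ℝ) ≤ 0)⟩ ⟨t, zero_le_one.trans ((hl t).resolve_left ht).ge⟩
    have hr' : fixedLevel f f' Γ (γ r) = 0 := hr
    rcases hl r with h | h <;> norm_num [hr'] at h

/-- The path stays in one end, where the projection to `G/K` or `G/L` is continuous and equivariant;
then `evalAt` is constant along its image. -/
theorem endValue_eq_of_joinedIn (a : F.val K × F.val L) {Γ : (Orb G)ᵒᵖ} {y y' : fixedSpace f f' Γ}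
    (h : JoinedIn ((gcwStructure f f').fixedSkeletonLT 1 Γ) y y') :
    endValue f f' a Γ y = endValue f f' a Γ y' := by
  rcases joinedIn_level f f' h with h | h
  · have h1 : fixedLevel f f' Γ y = -1 := h.source_mem
    have h2 : fixedLevel f f' Γ y' = -1 := h.target_mem
    have hlt : ∀ z, fixedLevel f f' Γ z = -1 → level f f' z.1 < 1 := fun z hz =>
      hz.trans_lt (by norm_num)
    rw [endValue, endValue, if_pos h1, if_pos h2]
    refine F.evalAt_eq_of_joinedIn a.1 (JoinedIn.mono (h.map_continuousOn
      (f := fun y => toLeft f f' y.1) ((continuousOn_toLeft f f').comp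
        (continuous_val f f' Γ).continuousOn hlt)) ?_)
    rintro _ ⟨z, hz, rfl⟩
    exact toLeft_mem f f' (hlt z hz)
  · have h1 : fixedLevel f f' Γ y = 1 := h.source_mem
    have h2 : fixedLevel f f' Γ y' = 1 := h.target_mem
    have hne : (1 : ℝ) ≠ -1 := by norm_num
    have hlt : ∀ z, fixedLevel f f' Γ z = 1 → -1 < level f f' z.1 := fun z hz =>
      lt_of_lt_of_eq (by norm_num) hz.symm
    rw [endValue, endValue, if_neg (h1.trans_ne hne), if_neg (h2.trans_ne hne), if_pos h1, if_pos h2]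
    refine F.evalAt_eq_of_joinedIn a.2 (JoinedIn.mono (h.map_continuousOn
      (f := fun y => toRight f f' y.1) ((continuousOn_toRight f f').comp
        (continuous_val f f' Γ).continuousOn hlt)) ?_)
    rintro _ ⟨z, hz, rfl⟩
    exact toRight_mem f f' (hlt z hz)

variable {F} in
/-- The singular `0`-cochain on the ends of the cylinder. -/
def endCochain (a : F.val K × F.val L) (Γ : (Orb G)ᵒᵖ) (σ : SingSimplex (fixedSpace f f' Γ) 0) :
    F.toFunctor.obj Γ :=
  endValue f f' a Γ (σ.toMap (stdSimplex.vertex 0))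

/-- The boundary of a 1-simplex in the ends is the difference of the end points of a path, where the
cochain takes equal values. -/
theorem endCochain_relBoundaries (a : F.val K × F.val L) (Γ : (Orb G)ᵒᵖ)
    (c : SingChain (fixedSpace f f' Γ) 0)
    (hc : c ∈ relBoundaries _ ((gcwStructure f f').fixedSkeletonLT 1 Γ)
      ((gcwStructure f f').fixedSkeletonLT 0 Γ) 0) :
    Finsupp.linearCombination ℤ (endCochain f f' a Γ) c = 0 := by
  obtain ⟨_, ⟨e, he, rfl⟩, b, hb, rfl⟩ := Submodule.mem_sup.mp hc
  -- `skeletonLT 0` is empty, so it supports no simplex and the relative term disappears.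
  have hb0 : b = 0 := by
    refine Finsupp.support_eq_empty.mp (Finset.eq_empty_of_forall_notMem fun σ hσ => ?_)
    have h : (σ.toMap (stdSimplex.vertex 0)).1 ∈ (gcwStructure f f').skeletonLT 0 := hb hσ _
    rwa [skeletonLT_zero] at h
  rw [hb0, add_zero]
  suffices h : chainsIn (fixedSpace f f' Γ) ((gcwStructure f f').fixedSkeletonLT 1 Γ) 1 ≤
      LinearMap.ker (Finsupp.linearCombination ℤ (endCochain f f' a Γ) ∘ₗ singBoundary _ 0) from
    h he
  rw [chainsIn, Finsupp.supported_eq_span_single, Submodule.span_le]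
  rintro _ ⟨σ, hσ, rfl⟩
  have h1 := singBoundary_edge σ.line (0 : ℝ) 1
  rw [edge_line] at h1
  change Finsupp.linearCombination ℤ (endCochain f f' a Γ)
    (singBoundary _ 0 (Finsupp.single σ 1)) = 0
  rw [h1, map_sub, sub_eq_zero, point, point, Finsupp.linearCombination_single,
    Finsupp.linearCombination_single, one_smul, one_smul, endCochain, endCochain, toMap_ofMap,
    toMap_ofMap]
  exact (endValue_eq_of_joinedIn f f' F a (JoinedIn.ofLine (f := σ.line)
    σ.line.continuous.continuousOn rfl rfl (by
      rintro _ ⟨r, -, rfl⟩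
      exact hσ _))).symm

theorem evalZero_surjective : Function.Surjective (evalZero f f' F) := fun a => by
  refine ⟨(gcwStructure f f').natTransOfCochain F (n := 0) (endCochain f f' a)
    (endCochain_relBoundaries f f' F a) (fun _ _ φ σ => endValue_map f f' F a φ _),
    Prod.ext ?_ ?_⟩
  · change Finsupp.linearCombination ℤ (endCochain f f' a (op K))
      (point (fixedLeft f f' (Γ := op K) (fixedBase K))) = a.1
    rw [point, Finsupp.linearCombination_single, one_smul, endCochain, toMap_ofMap]
    exact (if_pos rfl).trans (F.evalAt_base a.1)
  · change Finsupp.linearCombination ℤ (endCochain f f' a (op L))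
      (point (fixedRight f f' (Γ := op L) (fixedBase L))) = a.2
    rw [point, Finsupp.linearCombination_single, one_smul, endCochain, toMap_ofMap]
    have hne : (1 : ℝ) ≠ -1 := by norm_num
    exact (if_neg hne).trans ((if_pos rfl).trans (F.evalAt_base a.2))

/-- `0`-cochains are pairs of elements of `F(G/K)` and `F(G/L)`. -/
def evalZeroEquiv :
    ((gcwStructure f f').cellularChains 0 ⟶ F.toFunctor) ≃+ F.val K × F.val L :=
  AddEquiv.ofBijective (evalZero f f' F) ⟨evalZero_injective f f' F, evalZero_surjective f f' F⟩

/-! ### The coboundary and the cohomology -/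

/-- The boundary of the edge is its end point minus its starting point, and the gluing relation
moves these to `G/L` and `G/K`. -/
theorem cellularBoundary_lineClass {Γ : (Orb G)ᵒᵖ}
    (a : MulAction.fixedPoints Γ.unop.stab H.space) {b : MulAction.fixedPoints Γ.unop.stab K.space}
    {c : MulAction.fixedPoints Γ.unop.stab L.space} (hb : b.1 = f.toFun a.1)
    (hc : c.1 = f'.toFun a.1) :
    ((gcwStructure f f').cellularBoundary 0).app Γ (lineClass f f' a) =
      pointClass f f' (fixedRight_mem f f' c) - pointClass f f' (fixedLeft_mem f f' b) := by
  rw [lineClass, GCWStructure.cellularBoundary_cellClass]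
  refine congrArg (GCWStructure.cellClass _) (Subtype.ext ?_)
  change singBoundary _ 0 (edge (fixedLine f f' a) (-1) 1) =
    point (fixedRight f f' c) - point (fixedLeft f f' b)
  rw [singBoundary_edge]
  have hr : fixedLine f f' a 1 = fixedRight f f' c := Subtype.ext <| by
    change mk f f' (.inr (.inr (a.1, projIcc (-1) 1 _ 1))) = mk f f' (.inr (.inl c.1))
    rw [hc, ← mk_right, projIcc_right]
    rfl
  have hl : fixedLine f f' a (-1) = fixedLeft f f' b := Subtype.ext <| by
    change mk f f' (.inr (.inr (a.1, projIcc (-1) 1 _ (-1)))) = mk f f' (.inl b.1)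
    rw [hb, ← mk_left, projIcc_left]
    rfl
  rw [hr, hl]

theorem evalOne_cellularBoundary (φ : (gcwStructure f f').cellularChains 0 ⟶ F.toFunctor) :
    evalOne f f' F ((gcwStructure f f').cellularBoundary 0 ≫ φ) =
      F.pull f' (evalZero f f' F φ).2 - F.pull f (evalZero f f' F φ).1 := by
  -- A `G`-map out of `G/H` is classified by its value at the basepoint; this lets `F(f)` and
  -- `F(f')` be read off from the values of `φ` on the two end points.
  have hmem : ∀ {M : Orb G} (h : H ⟶ M),
      h.toFun H.base ∈ MulAction.fixedPoints H.stab M.space := fun h =>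
    MulAction.mem_fixedPoints_of_smul (fun g => h.map_smul g H.base) H.base_mem_fixedPoints
  have hof : ∀ {M : Orb G} (h : H ⟶ M), Orb.ofFixed ⟨_, hmem h⟩ = h := fun h =>
    Orb.hom_ext_base (Orb.ofFixed_base ⟨_, hmem h⟩)
  change φ.app (op H) (((gcwStructure f f').cellularBoundary 0).app (op H)
    (lineClass f f' (Γ := op H) (fixedBase H))) = _
  rw [cellularBoundary_lineClass f f' (Γ := op H) (fixedBase H) (b := ⟨_, hmem f⟩)
    (c := ⟨_, hmem f'⟩) rfl rfl]
  refine (map_sub (φ.app (op H)).hom _ _).trans ?_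
  have h1 := app_fixedRight f f' φ (Γ := H) ⟨_, hmem f'⟩
  have h2 := app_fixedLeft f f' φ (Γ := H) ⟨_, hmem f⟩
  rw [hof] at h1 h2
  exact congrArg₂ (· - ·) h1 h2

/-- For `n ≥ 2` the `(n-1)`-skeleton is already everything, so every chain is a relative boundary
and the empty set generates. -/
theorem subsingleton_cochains {n : ℕ} (hn : 2 ≤ n) :
    Subsingleton ((gcwStructure f f').cellularChains n ⟶ F.toFunctor) := by
  refine ⟨fun φ ψ => NatTrans.ext (funext fun Γ => AddCommGrpCat.hom_ext ?_)⟩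
  refine GCWStructure.eq_of_generators (S := gcwStructure f f') (n := n)
    (φ.app Γ).hom (ψ.app Γ).hom ∅ (empty_subset _) (fun c _ => ?_) (fun _ h => h.elim)
  refine Submodule.mem_sup_left (Submodule.mem_sup_right fun σ _ t => ?_)
  change _ ∈ (gcwStructure f f').skeletonLT n
  rw [skeletonLT_of_two_le f f' hn]
  trivial

theorem evalOne_d (φ : (gcwStructure f f').cellularChains 0 ⟶ F.toFunctor) :
    evalOne f f' F ((((gcwStructure f f').bredonComplex F).d 0 1).hom φ) =
      F.pull f' (evalZero f f' F φ).2 - F.pull f (evalZero f f' F φ).1 :=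
  (congrArg (evalOne f f' F) ((gcwStructure f f').bredonComplex_d F 0 φ)).trans
    (evalOne_cellularBoundary f f' F φ)

theorem subsingleton_bredonCohomology {n : ℕ} (hn : 2 ≤ n) :
    Subsingleton ((gcwStructure f f').bredonCohomology F n) := by
  have := subsingleton_cochains f f' F hn
  have h0 : Limits.IsZero (((gcwStructure f f').bredonComplex F).X n) :=
    @AddCommGrpCat.isZero_of_subsingleton (AddCommGrpCat.of _) this
  exact AddCommGrpCat.subsingleton_of_isZero
    (ShortComplex.isZero_homology_of_isZero_X₂ (((gcwStructure f f').bredonComplex F).sc n) h0)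

theorem nonempty_bredonCohomology_zero : Nonempty ((gcwStructure f f').bredonCohomology F 0 ≃+
    (((F.pull f).comp (AddMonoidHom.fst (F.val K) (F.val L))).eqLocus
      ((F.pull f').comp (AddMonoidHom.snd (F.val K) (F.val L))))) := by
  let C := (gcwStructure f f').bredonComplex F
  -- In degree `0` the predecessor index is `0` itself, and the incoming map `d 0 0` vanishes by the
  -- shape of the complex.
  obtain ⟨e⟩ := nonempty_homology_equiv_ker (C.sc' 0 0 1) (C.shape 0 0 (by simp))
  have e' : (gcwStructure f f').bredonCohomology F 0 ≃+ (C.sc' 0 0 1).homology :=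
    (C.homologyIsoSc' 0 0 1 (by simp) (by simp)).addCommGroupIsoToAddEquiv
  have h : (C.d 0 1).hom.ker.map (evalZeroEquiv f f' F).toAddMonoidHom =
      ((F.pull f).comp (AddMonoidHom.fst (F.val K) (F.val L))).eqLocus
      ((F.pull f').comp (AddMonoidHom.snd (F.val K) (F.val L))) := by
    ext x
    obtain ⟨φ, rfl⟩ := (evalZeroEquiv f f' F).surjective x
    refine (AddSubgroup.mem_map_iff_mem (evalZeroEquiv f f' F).injective).trans ?_
    -- Since `evalOne` is injective, the vanishing of the coboundary can be tested in `F(G/H)`,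
    -- where it reads `F(f')(c) - F(f)(b) = 0`.
    refine (map_eq_zero_iff (evalOne f f' F) (evalOne_injective f f' F)).symm.trans ?_
    refine (Eq.congr_left (evalOne_d f f' F φ)).trans ?_
    rw [sub_eq_zero, eq_comm]
    rfl
  exact ⟨(e'.trans e).trans (((evalZeroEquiv f f' F).addSubgroupMap _).trans
    (AddEquiv.addSubgroupCongr h))⟩

theorem nonempty_bredonCohomology_one : Nonempty ((gcwStructure f f').bredonCohomology F 1 ≃+
    (F.val H ⧸ ((F.pull f).range ⊔ (F.pull f').range))) := by
  let C := (gcwStructure f f').bredonComplex F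
  -- There are no nonzero 2-cochains, so `H¹` is the cokernel of `d 0 1`.
  have h2 : C.d 1 2 = 0 := by
    refine AddCommGrpCat.hom_ext (AddMonoidHom.ext fun φ => ?_)
    exact (subsingleton_cochains f f' F le_rfl).elim _ _
  obtain ⟨e⟩ := nonempty_homology_equiv_quotient (C.sc' 0 1 2) h2
  have e' : (gcwStructure f f').bredonCohomology F 1 ≃+ (C.sc' 0 1 2).homology :=
    (C.homologyIsoSc' 0 1 2 (by simp) (by simp)).addCommGroupIsoToAddEquiv
  have h : (C.d 0 1).hom.range.map (evalOneEquiv f f' F).toAddMonoidHom =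
      (F.pull f).range ⊔ (F.pull f').range := by
    apply le_antisymm
    · rintro _ ⟨_, ⟨φ, rfl⟩, rfl⟩
      refine (evalOne_d f f' F φ).symm ▸ ?_
      rw [sub_eq_neg_add]
      exact AddSubgroup.add_mem_sup (neg_mem ⟨_, rfl⟩) ⟨_, rfl⟩
    -- Every pair is realised by a 0-cochain; the pairs `(a, 0)` and `(0, b)` yield the two images
    -- separately, the first up to sign.
    · have hd : ∀ x : F.val K × F.val L, F.pull f' x.2 - F.pull f x.1 ∈
          (C.d 0 1).hom.range.map (evalOneEquiv f f' F).toAddMonoidHom := fun x => by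
        obtain ⟨φ, rfl⟩ := evalZero_surjective f f' F x
        exact ⟨C.d 0 1 φ, ⟨φ, rfl⟩, evalOne_d f f' F φ⟩
      refine sup_le ?_ ?_
      · rintro _ ⟨a, rfl⟩
        simpa using neg_mem (hd (a, 0))
      · rintro _ ⟨b, rfl⟩
        simpa using hd (0, b)
  exact ⟨(e'.trans e).trans (QuotientAddGroup.congr _ _ (evalOneEquiv f f' F) h)⟩

end DoubleMappingCylinder

end

/-! ### The theorem for the projections of orbits -/

theorem mainTheorem10 {G : Type u} [Group G] [TopologicalSpace G] [IsTopologicalGroup G]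
    [LocallyCompactSpace G] (H Km Kp : Orb G)
    (hm : H.stab ≤ Km.stab) (hp : H.stab ≤ Kp.stab) (F : CoefficientSystem G) :
    (∀ n : ℕ, 2 ≤ n → Subsingleton
      ((DoubleMappingCylinder.gcwStructure (Orb.proj hm) (Orb.proj hp)).bredonCohomology F n)) ∧
    Nonempty
      ((DoubleMappingCylinder.gcwStructure (Orb.proj hm) (Orb.proj hp)).bredonCohomology F 0 ≃+
        (((F.pull (Orb.proj hm)).comp (AddMonoidHom.fst (F.val Km) (F.val Kp))).eqLocus
          ((F.pull (Orb.proj hp)).comp (AddMonoidHom.snd (F.val Km) (F.val Kp))))) ∧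
    Nonempty
      ((DoubleMappingCylinder.gcwStructure (Orb.proj hm) (Orb.proj hp)).bredonCohomology F 1 ≃+
        (F.val H ⧸ ((F.pull (Orb.proj hm)).range ⊔ (F.pull (Orb.proj hp)).range))) := by
  exact ⟨fun n hn => DoubleMappingCylinder.subsingleton_bredonCohomology _ _ F hn,
    DoubleMappingCylinder.nonempty_bredonCohomology_zero _ _ F,
    DoubleMappingCylinder.nonempty_bredonCohomology_one _ _ F⟩
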